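/- Let $N\ge 0$ and let $$\mathcal F_\lambda:\quad x\,(1+a(x,y,\lambda))\,dy+\alpha(\lambda)\,y\,(1+b(x,y,\lambda))\,dx=0,\qquad \alpha(0)>0,$$ be a family of real analytic plane foliations, where $\alpha$ is real analytic near $0\in\mathbb R^N$, $a,b$ are real analytic near the origin of $\mathbb R^2\times\mathbb R^N$, and $a(0,0,\lambda)=b(0,0,\lambda)=0$ for all small $\lambda$. Thus the origin is a saddle point with separatrices $\{x=0\}$ and $\{y=0\}$. Fix a sufficiently small $r>0$; leaves and orbits are considered in the polydisc $|x|<r,\ |y|<r$ of $\mathbb R^2$ or, for the complexified foliation, of $\mathbb C^2$. Let $0<c_1,c_2<r$, and let $\sigma\subset\{y=c_1\}$ and $\tau\subset\{x=c_2\}$ be small complex discs centred at $(0,c_1)$ and $(c_2,0)$ and parameterized by $x$ and $y$ respectively. For small real $\lambda$ and small $x>0$, let $\mathcal D_\lambda(x)>0$ be the $y$-coordinate of the point at which the real orbit of $\mathcal F_\lambda$ that starts at $(x,c_1)$ and runs in the open first quadrant meets $\tau$ (the Dulac map), and let $\mathcal D_\lambda^{-1}$ be the inverse map. Let $h^\lambda_\sigma$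 (respectively $h^\lambda_\tau$) be the holonomy map on $\sigma$ (respectively $\tau$) of the separatrix $\{x=0\}$ (respectively $\{y=0\}$), obtained by lifting to the leaves of the complexified foliation the loop $y=c_1e^{i\theta}$ (respectively $x=c_2e^{i\theta}$), $0\le\theta\le 2\pi$. For a function $f$ on an interval of positive reals and a point $s>0$ of it, let $f(e^{2\pi i}s)$ be the value at the end point of the analytic continuation of $f$ along the arc $s e^{i\theta}$, $0\le\theta\le2\pi$. Then there is $\varepsilon>0$ such that for all $\lambda\in\mathbb R^N$ with $|\lambda|<\varepsilon$ and all $x,y\in(0,\varepsilon)$ the values $\mathcal D_\lambda(x)$, $\mathcal D_\lambda(e^{2\pi i}x)$, $\mathcal D^{-1}_\lambda(y)$, $\mathcal D^{-1}_\lambda(e^{2\pi i}y)$ and the values of the holonomy maps below exist and are uniquely determined, and $$h^\lambda_\tau\big(\mathcal D_\lambda(e^{2\pi i}x)\big)=\mathcal D_\lambda(x),\qquad h^\lambda_\sigma\big(\mathcal D^{-1}_\lambda(e^{2\pi i}y)\big)=\mathcal D^{-1}_\lambda(y).$$ -/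

import Mathlib

open Set Filter Topology

noncomputable section

namespace SaddleFoliation

/-! ### Complexification of a real analytic germ -/

/-- The real phase-parameter space `ℝ² × ℝ^N` with coordinates `(x, y, lam)`. -/
abbrev RealSpace (N : ℕ) : Type := ℝ × ℝ × EuclideanSpace ℝ (Fin N)

/-- The complex phase-parameter space `ℂ² × ℂ^N`. -/
abbrev ComplexSpace (N : ℕ) : Type := ℂ × ℂ × EuclideanSpace ℂ (Fin N)

/-- The inclusion `ℝ^N ⊆ ℂ^N`. -/
def toComplexParam {N : ℕ} (lam : EuclideanSpace ℝ (Fin N)) : EuclideanSpace ℂ (Fin N) :=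
  WithLp.toLp 2 fun i => (lam i : ℂ)

/-- The inclusion `ℝ² × ℝ^N ⊆ ℂ² × ℂ^N`. -/
def toComplexSpace {N : ℕ} (p : RealSpace N) : ComplexSpace N :=
  ((p.1 : ℂ), (p.2.1 : ℂ), toComplexParam p.2.2)

/-- `F` is a holomorphic germ at the origin of `ℂ² × ℂ^N` that extends the germ of `f` at the
origin of `ℝ² × ℝ^N`. -/
def IsComplexification {N : ℕ} (f : RealSpace N → ℝ) (F : ComplexSpace N → ℂ) : Prop :=
  AnalyticAt ℂ F 0 ∧ ∀ᶠ p in 𝓝 (0 : RealSpace N), F (toComplexSpace p) = (f p : ℂ)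

/-- The complexification of (the germ at the origin of) a real analytic function. -/
def complexification {N : ℕ} (f : RealSpace N → ℝ) : ComplexSpace N → ℂ :=
  Classical.epsilon (IsComplexification f)

theorem exists_holomorphic_extension {V W J : Type*} [NormedAddCommGroup V] [NormedSpace ℝ V]
    [NormedAddCommGroup W] [NormedSpace ℂ W] [Fintype J] (ι : V → W)
    (hι : Tendsto ι (𝓝 0) (𝓝 0)) (e : J → V) (c : J → V → ℝ) (L : J → W →L[ℂ] ℂ)
    (hL : ∀ j v, L j (ι v) = (c j v : ℂ)) (he : ∀ v, ∑ j, c j v • e j = v)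
    (f : V → ℝ) (hf : AnalyticAt ℝ f 0) :
    ∃ F : W → ℂ, AnalyticAt ℂ F 0 ∧ ∀ᶠ v in 𝓝 (0 : V), F (ι v) = (f v : ℂ) := by
  classical
  obtain ⟨p, ρ, hp⟩ := hf
  let q : FormalMultilinearSeries ℂ W ℂ := fun n =>
    ∑ j : Fin n → J, ((p n fun k => e (j k) : ℝ) : ℂ) •
      (ContinuousMultilinearMap.mkPiAlgebra ℂ (Fin n) ℂ).compContinuousLinearMap
        (fun k => L (j k))
  have hq : ∀ n v, q n (fun _ => ι v) = ((p n fun _ => v : ℝ) : ℂ) := by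
    intro n v
    have h1 : (p n fun _ => v) = p n (fun _ => ∑ j, c j v • e j) := by rw [he v]
    rw [h1, ContinuousMultilinearMap.map_sum]
    simp only [q, _root_.sum_apply, _root_.smul_apply,
      ContinuousMultilinearMap.compContinuousLinearMap_apply,
      ContinuousMultilinearMap.mkPiAlgebra_apply, hL, smul_eq_mul,
      ContinuousMultilinearMap.map_smul_univ]
    push_cast
    exact Finset.sum_congr rfl fun j _ => mul_comm _ _
  set K : ℝ := ∑ j, ‖e j‖ * ‖L j‖ with hK
  have hK0 : 0 ≤ K := Finset.sum_nonneg fun j _ => by positivity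
  have hbound : ∀ n, ‖q n‖ ≤ ‖p n‖ * K ^ n := by
    intro n
    have h2 : K ^ n = ∑ j : Fin n → J, ∏ k, (‖e (j k)‖ * ‖L (j k)‖) := by
      have := Finset.prod_univ_sum (fun _ : Fin n => (Finset.univ : Finset J))
        (fun _ j => ‖e j‖ * ‖L j‖)
      simpa [Fintype.piFinset_univ] using this
    rw [h2, Finset.mul_sum]
    refine (norm_sum_le _ _).trans (Finset.sum_le_sum fun j _ => ?_)
    rw [norm_smul, Finset.prod_mul_distrib, ← mul_assoc]
    gcongr
    · rw [Complex.norm_real]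
      exact (p n).le_opNorm _
    · refine (ContinuousMultilinearMap.norm_compContinuousLinearMap_le _ _).trans ?_
      rw [ContinuousMultilinearMap.norm_mkPiAlgebra, one_mul]
  obtain ⟨C, r, hC, hr, hCr⟩ := p.le_mul_pow_of_radius_pos hp.radius_pos
  have hD : 0 < r * K + 1 := by positivity
  have hrad : 0 < q.radius := by
    let s : NNReal := ⟨(r * K + 1)⁻¹, by positivity⟩
    have hs : (0 : ENNReal) < s := by
      have : (0 : ℝ) < (r * K + 1)⁻¹ := by positivity
      exact_mod_cast this
    refine hs.trans_le (q.le_radius_of_bound C fun n => ?_)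
    calc ‖q n‖ * (s : ℝ) ^ n ≤ (C * r ^ n * K ^ n) * ((r * K + 1)⁻¹) ^ n := by
          change _ * ((r * K + 1)⁻¹) ^ n ≤ _
          gcongr
          exact (hbound n).trans (by gcongr; exact hCr n)
      _ = C * (r * K * (r * K + 1)⁻¹) ^ n := by rw [mul_pow, mul_pow]; ring
      _ ≤ C * 1 := by
          gcongr
          refine pow_le_one₀ (by positivity) ?_
          rw [← div_eq_mul_inv, div_le_one hD]
          linarith
      _ = C := mul_one C
  have hQ := q.hasFPowerSeriesOnBall hrad
  refine ⟨q.sum, hQ.analyticAt, ?_⟩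
  filter_upwards [Metric.eball_mem_nhds (0 : V) hp.r_pos,
    hι.eventually (Metric.eball_mem_nhds (0 : W) hrad)] with v hv hv'
  have h1 := hp.hasSum hv
  have h2 := hQ.hasSum hv'
  simp only [zero_add, hq] at h1 h2
  exact h2.unique ((Complex.hasSum_ofReal).2 h1)

theorem exists_isComplexification {N : ℕ} (f : RealSpace N → ℝ) (hf : AnalyticAt ℝ f 0) :
    ∃ F, IsComplexification f F := by
  classical
  refine exists_holomorphic_extension (J := Unit ⊕ Unit ⊕ Fin N) toComplexSpace ?_
    (Sum.elim (fun _ => (1, 0, 0)) (Sum.elim (fun _ => (0, 1, 0))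
      fun i => (0, 0, EuclideanSpace.single i 1)))
    (Sum.elim (fun _ p => p.1) (Sum.elim (fun _ p => p.2.1) fun i p => p.2.2 i))
    (Sum.elim (fun _ => ContinuousLinearMap.fst ℂ _ _)
      (Sum.elim (fun _ => (ContinuousLinearMap.fst ℂ _ _).comp (ContinuousLinearMap.snd ℂ _ _))
        fun i => (EuclideanSpace.proj i).comp
          ((ContinuousLinearMap.snd ℂ _ _).comp (ContinuousLinearMap.snd ℂ _ _)))) ?_ ?_ f hf
  · have h : Continuous (toComplexSpace : RealSpace N → ComplexSpace N) := by
      unfold toComplexSpace toComplexParam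
      fun_prop
    have h0 : toComplexSpace (0 : RealSpace N) = 0 := by
      simp [toComplexSpace, toComplexParam, Prod.ext_iff]
      rfl
    simpa [h0] using h.tendsto 0
  · rintro (_ | _ | i) v <;> simp [toComplexSpace, toComplexParam]
  · rintro ⟨x, y, l⟩
    simp only [Fintype.sum_sum_type, Sum.elim_inl, Sum.elim_inr, Finset.univ_unique,
      Finset.sum_singleton, Prod.smul_mk, smul_eq_mul, mul_one, mul_zero, smul_zero]
    ext i <;> simp [Prod.fst_sum, Prod.snd_sum, Finset.sum_apply, Pi.single_apply]

theorem complexification_spec {N : ℕ} (f : RealSpace N → ℝ) (hf : AnalyticAt ℝ f 0) :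
    IsComplexification f (complexification f) :=
  Classical.epsilon_spec (exists_isComplexification f hf)

/-! ### The foliation -/

/-- An analytic family of real analytic plane foliations
`x (1 + a) dy + α(lam) y (1 + b) dx = 0`, `lam ∈ ℝ^N`, `α(0) > 0`, with a saddle point at the
origin whose separatrices are the coordinate axes. The functions `a(x, y, lam)` and `b(x, y, lam)`
(the higher order terms) are real analytic near the origin and vanish at `x = y = 0`. -/
structure Family (N : ℕ) where
  α : EuclideanSpace ℝ (Fin N) → ℝ
  a : RealSpace N → ℝ
  b : RealSpace N → ℝ
  analyticAt_α : AnalyticAt ℝ α 0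
  analyticAt_a : AnalyticAt ℝ a 0
  analyticAt_b : AnalyticAt ℝ b 0
  α_pos : 0 < α 0
  a_zero : ∀ᶠ lam in 𝓝 (0 : EuclideanSpace ℝ (Fin N)), a (0, 0, lam) = 0
  b_zero : ∀ᶠ lam in 𝓝 (0 : EuclideanSpace ℝ (Fin N)), b (0, 0, lam) = 0

variable {N : ℕ}

/-- The complexified one-form `x (1 + a) dy + α y (1 + b) dx` at the point `p = (x, y) ∈ ℂ²`,
evaluated at the tangent vector `v = (dx, dy)`. -/
def Family.form (S : Family N) (lam : EuclideanSpace ℝ (Fin N)) (p v : ℂ × ℂ) : ℂ :=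
  p.1 * (1 + complexification S.a (p.1, p.2, toComplexParam lam)) * v.2 +
    (S.α lam : ℂ) * p.2 * (1 + complexification S.b (p.1, p.2, toComplexParam lam)) * v.1

/-- A differentiable path `γ : [0, T] → ℂ²` inside the polydisc `|x| < r, |y| < r`, punctured at
the singular point, that is tangent to the complex foliation, i.e. that runs inside a leaf. -/
def Family.IsLeafPath (S : Family N) (r : ℝ) (lam : EuclideanSpace ℝ (Fin N)) (T : ℝ)
    (γ : ℝ → ℂ × ℂ) : Prop :=
  ∀ t ∈ Icc 0 T, ‖(γ t).1‖ < r ∧ ‖(γ t).2‖ < r ∧ γ t ≠ 0 ∧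
    ∃ v, HasDerivWithinAt γ v (Icc 0 T) t ∧ S.form lam (γ t) v = 0

/-! ### Holonomy of the separatrices -/

/-- `z'` is the image of `z` under the holonomy map of the separatrix `{x = 0}`, on the
cross-section `σ ⊆ {y = c₁}` parameterized by `x`: the loop `y = c₁ exp (i θ)`, `0 ≤ θ ≤ 2 π`, in
the separatrix lifts to a path in a leaf which goes from `(z, c₁)` to `(z', c₁)`. -/
def Family.IsHolonomyσ (S : Family N) (r c₁ : ℝ) (lam : EuclideanSpace ℝ (Fin N))
    (z z' : ℂ) : Prop :=
  ∃ γ : ℝ → ℂ × ℂ, S.IsLeafPath r lam (2 * Real.pi) γ ∧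
    (∀ θ ∈ Icc 0 (2 * Real.pi), (γ θ).2 = c₁ * Complex.exp (θ * Complex.I)) ∧
    (γ 0).1 = z ∧ (γ (2 * Real.pi)).1 = z'

/-- `w'` is the image of `w` under the holonomy map of the separatrix `{y = 0}`, on the
cross-section `τ ⊆ {x = c₂}` parameterized by `y`: the loop `x = c₂ exp (i θ)`, `0 ≤ θ ≤ 2 π`, in
the separatrix lifts to a path in a leaf which goes from `(c₂, w)` to `(c₂, w')`. -/
def Family.IsHolonomyτ (S : Family N) (r c₂ : ℝ) (lam : EuclideanSpace ℝ (Fin N))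
    (w w' : ℂ) : Prop :=
  ∃ γ : ℝ → ℂ × ℂ, S.IsLeafPath r lam (2 * Real.pi) γ ∧
    (∀ θ ∈ Icc 0 (2 * Real.pi), (γ θ).1 = c₂ * Complex.exp (θ * Complex.I)) ∧
    (γ 0).2 = w ∧ (γ (2 * Real.pi)).2 = w'

/-- The holonomy map `h_σ` of the separatrix `{x = 0}` (junk where undefined). -/
def Family.holonomyσ (S : Family N) (r c₁ : ℝ) (lam : EuclideanSpace ℝ (Fin N)) (z : ℂ) : ℂ :=
  Classical.epsilon (S.IsHolonomyσ r c₁ lam z)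

/-- The holonomy map `h_τ` of the separatrix `{y = 0}` (junk where undefined). -/
def Family.holonomyτ (S : Family N) (r c₂ : ℝ) (lam : EuclideanSpace ℝ (Fin N)) (w : ℂ) : ℂ :=
  Classical.epsilon (S.IsHolonomyτ r c₂ lam w)

/-! ### The Dulac map -/

/-- The orbit of the real foliation, i.e. of the vector field
`x' = x (1 + a)`, `y' = - α y (1 + b)` spanning the kernel of the one-form, which starts at the
point `(x, c₁)` of `σ ∩ ℝ_{>0}`, runs inside the open first quadrant (and the square of size `r`)
and meets `τ` at the point `(c₂, y)`. -/
def Family.IsDulac (S : Family N) (r c₁ c₂ : ℝ) (lam : EuclideanSpace ℝ (Fin N))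
    (x y : ℝ) : Prop :=
  ∃ (T : ℝ) (u v : ℝ → ℝ), 0 ≤ T ∧
    (∀ t ∈ Icc 0 T, u t ∈ Ioo 0 r ∧ v t ∈ Ioo 0 r ∧
      HasDerivWithinAt u (u t * (1 + S.a (u t, v t, lam))) (Icc 0 T) t ∧
      HasDerivWithinAt v (-(S.α lam * v t * (1 + S.b (u t, v t, lam)))) (Icc 0 T) t) ∧
    u 0 = x ∧ v 0 = c₁ ∧ u T = c₂ ∧ v T = y

/-- The real Dulac map (junk where undefined). -/
def Family.dulac (S : Family N) (r c₁ c₂ : ℝ) (lam : EuclideanSpace ℝ (Fin N)) (x : ℝ) : ℝ :=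
  Classical.epsilon fun y => S.IsDulac r c₁ c₂ lam x y

/-- The inverse of the real Dulac map (junk where undefined). -/
def Family.dulacInv (S : Family N) (r c₁ c₂ : ℝ) (lam : EuclideanSpace ℝ (Fin N)) (y : ℝ) : ℝ :=
  Classical.epsilon fun x => S.IsDulac r c₁ c₂ lam x y

/-! ### Analytic continuation along an arc -/

/-- `w` is the value at the end point of the analytic continuation of the germ of `f` at `x`
along the arc `x exp (i θ)`, `0 ≤ θ ≤ 2 π`: there are holomorphic germs `F θ` at the points of the
arc, such that germs at close points are restrictions of each other, and the first of which agrees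
with `f` on the real axis near `x`. -/
def IsArcContinuation (f : ℝ → ℝ) (x : ℝ) (w : ℂ) : Prop :=
  ∃ F : ℝ → ℂ → ℂ,
    (∀ θ ∈ Icc 0 (2 * Real.pi), AnalyticAt ℂ (F θ) (x * Complex.exp (θ * Complex.I))) ∧
    (∀ θ ∈ Icc 0 (2 * Real.pi), ∀ᶠ θ' : ℝ in 𝓝[Icc 0 (2 * Real.pi)] θ,
      F θ' =ᶠ[𝓝 (x * Complex.exp (θ' * Complex.I))] F θ) ∧
    (∀ᶠ s : ℝ in 𝓝 x, F 0 (s : ℂ) = (f s : ℂ)) ∧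
    F (2 * Real.pi) (x : ℂ) = w

/-- `f (exp (2 π i) x)`, the result of the analytic continuation of `f` along the arc of radius
`x` and angle `2 π` (junk where the continuation does not exist). -/
def arcContinuation (f : ℝ → ℝ) (x : ℝ) : ℂ :=
  Classical.epsilon (IsArcContinuation f x)

end SaddleFoliation

end

/-!
In the logarithmic coordinates `x = exp ζ`, `y = exp η` the leaves are the solutions of
`dη / dζ = h(ζ, η) = -α (1 + b) / (1 + a)`, a function close to `-α` and `2 π i`-periodic in `ζ`.
Along a segment of direction `v` with `|Im v| ≤ Re v` the real part of `v h` is nonpositive, so `|y|`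
decreases and the transport of `y = c₁` along the segment never leaves the polydisc. All Picard
iterates have this property, so they converge on the whole segment and the transport depends
holomorphically on the end points of the segment (`exists_holomorphic_solution`,
`Saddle.IsRegular.exists_lift`).

Write `P(ζ, ζ')` for the transport from `ζ` to `ζ'`. On the real axis `P(log x, log c₂)` is the
logarithm of the Dulac map `D` (`Saddle.IsLift.isDulac`, `Saddle.IsLift.dulac_unique`). Hence the Dulac
map continues analytically along the arc, with value `exp P(log x + 2 π i, log c₂)` at its end, which
by periodicity is `exp P(log x, log c₂ - 2 π i)`. As a function of its end point, `P(log x, ·)` solves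
the equation of the leaves (`Saddle.hasDerivAt_lift_end`); moving the end point from
`log c₂ - 2 π i` up to `log c₂` therefore lifts the loop `x = c₂ exp (i θ)` to a path in a leaf, which
goes from `D(exp (2 π i) x)` to `exp P(log x, log c₂) = D(x)`. This is the relation for `h_τ`, and it
holds for all `x < c₂ exp (-10)`, uniformly in the family, since only `|Im v| ≤ Re v` is needed.

The relation for `h_σ` is the same relation for the foliation with the coordinates exchanged, which
replaces `α` by `1 / α`; orbits correspond by reversing and rescaling time.
-/

noncomputable section

namespace SaddleFoliation

/-! ### Holomorphic dependence of solutions on parameters -/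

/-- Differentiation under the integral sign for a bounded family of holomorphic functions; the
derivatives are dominated by the Cauchy estimate. -/
theorem differentiableOn_intervalIntegral_of_bounded {U : Set ℂ} (hU : IsOpen U)
    {g : ℝ → ℂ → ℂ} {M s : ℝ} (hs : 0 ≤ s)
    (hc : ∀ p ∈ U, ContinuousOn (fun t => g t p) (Icc 0 s))
    (hd : ∀ t ∈ Icc 0 s, DifferentiableOn ℂ (g t) U)
    (hM : ∀ t ∈ Icc 0 s, ∀ p ∈ U, ‖g t p‖ ≤ M) :
    DifferentiableOn ℂ (fun p => ∫ t in (0 : ℝ)..s, g t p) U := by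
  intro p hp
  obtain ⟨δ, hδ, hδU⟩ := Metric.isOpen_iff.1 hU p hp
  have hI : Set.uIoc 0 s ⊆ Icc 0 s := by
    rw [uIoc_of_le hs]; exact Ioc_subset_Icc_self
  have hsub : ∀ q ∈ Metric.ball p (δ / 2), Metric.closedBall q (δ / 2) ⊆ U := by
    intro q hq z hz
    refine hδU ?_
    have h1 := dist_triangle z q p
    simp only [Metric.mem_ball, Metric.mem_closedBall] at *
    linarith
  have hmeas : ∀ q ∈ U, MeasureTheory.AEStronglyMeasurable (fun t => g t q)
      (MeasureTheory.volume.restrict (Set.uIoc 0 s)) := fun q hq =>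
    ((hc q hq).mono hI).aestronglyMeasurable measurableSet_uIoc
  have hder : ∀ t ∈ Icc 0 s, ∀ q ∈ U, HasDerivAt (g t) (deriv (g t) q) q := fun t ht q hq =>
    ((hd t ht q hq).differentiableAt (hU.mem_nhds hq)).hasDerivAt
  have key := intervalIntegral.hasDerivAt_integral_of_dominated_loc_of_deriv_le
    (𝕜 := ℂ) (μ := MeasureTheory.volume) (a := 0) (b := s) (F := fun q t => g t q)
    (F' := fun q t => deriv (g t) q) (x₀ := p) (s := Metric.ball p (δ / 2))
    (bound := fun _ => M / (δ / 2)) (Metric.ball_mem_nhds p (by positivity)) ?_ ?_ ?_ ?_ ?_ ?_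
  · exact key.2.differentiableAt.differentiableWithinAt
  · filter_upwards [hU.mem_nhds hp] with q hq using hmeas q hq
  · refine ContinuousOn.intervalIntegrable ?_
    rw [uIcc_of_le hs]
    exact hc p hp
  · -- the derivative is a pointwise limit of difference quotients
    obtain ⟨u, hu0, hu⟩ : ∃ u : ℕ → ℂ, (∀ n, u n ≠ 0 ∧ p + u n ∈ U) ∧ Tendsto u atTop (𝓝 0) := by
      have h1 : Tendsto (fun n : ℕ => ((δ / 2 : ℝ) : ℂ) * ((n : ℂ) + 1)⁻¹) atTop (𝓝 0) := by
        have := (tendsto_one_div_add_atTop_nhds_zero_nat (𝕜 := ℂ)).const_mul ((δ / 2 : ℝ) : ℂ)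
        simpa using this
      refine ⟨_, fun n => ⟨?_, hδU ?_⟩, h1⟩
      · have h2 : (n : ℂ) + 1 ≠ 0 := Nat.cast_add_one_ne_zero n
        have h3 : ((δ / 2 : ℝ) : ℂ) ≠ 0 := by
          exact_mod_cast (by positivity : δ / 2 ≠ 0)
        exact mul_ne_zero h3 (inv_ne_zero h2)
      · have h2 : ‖(n : ℂ) + 1‖ = n + 1 := by
          rw [show ((n : ℂ) + 1) = ((n + 1 : ℕ) : ℂ) by push_cast; rfl, Complex.norm_natCast]
          push_cast; rfl
        rw [Metric.mem_ball, dist_eq_norm, add_sub_cancel_left, norm_mul, norm_inv, h2,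
          Complex.norm_real, Real.norm_of_nonneg (by positivity)]
        have h3 : ((n : ℝ) + 1)⁻¹ ≤ 1 := inv_le_one_of_one_le₀ (by linarith [n.cast_nonneg (α := ℝ)])
        nlinarith
    refine aestronglyMeasurable_of_tendsto_ae atTop
      (f := fun n t => (u n)⁻¹ • (g t (p + u n) - g t p)) (fun n => ?_) ?_
    · exact ((hmeas _ (hu0 n).2).sub (hmeas p hp)).const_smul (u n)⁻¹
    · refine (MeasureTheory.ae_restrict_mem measurableSet_uIoc).mono fun t ht => ?_
      have h2 := (hder t (hI ht) p hp).tendsto_slope_zero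
      exact h2.comp (tendsto_nhdsWithin_iff.2 ⟨hu, Eventually.of_forall fun n => (hu0 n).1⟩)
  · refine Eventually.of_forall fun t ht q hq => ?_
    have h1 : DifferentiableOn ℂ (g t) (Metric.closedBall q (δ / 2)) :=
      (hd t (hI ht)).mono (hsub q hq)
    refine Complex.norm_deriv_le_of_forall_mem_sphere_norm_le (by positivity)
      (h1.diffContOnCl_ball subset_rfl) fun z hz => ?_
    exact hM t (hI ht) z (hsub q hq (Metric.sphere_subset_closedBall hz))
  · exact intervalIntegrable_const
  · refine Eventually.of_forall fun t ht q hq => hder t (hI ht) q (hsub q hq ?_)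
    exact Metric.mem_closedBall_self (by positivity)

/-- The `n`-th Picard iterate of the equation `y' = f(s, p, y)`, `y(0) = c`. -/
def picardIterate (f : ℝ → ℂ → ℂ → ℂ) (c : ℝ) : ℕ → ℝ → ℂ → ℂ
  | 0 => fun _ _ => c
  | n + 1 => fun s p => c + ∫ t in (0 : ℝ)..s, f t p (picardIterate f c n t p)

/-- A differential equation on `[0, 1]` with values in a half-plane `Re y ≤ c`, whose right-hand
side never points out of the half-plane, has a solution which starts at `c` and depends
holomorphically on the parameter. Every Picard iterate stays in the half-plane, since it is `c`
plus the integral of a function with nonpositive real part; so the iteration converges on the whole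
interval. -/
theorem exists_holomorphic_solution {U : Set ℂ} (hU : IsOpen U) {c M K : ℝ} (hK : 0 < K)
    {f : ℝ → ℂ → ℂ → ℂ}
    (hcont : ∀ p ∈ U, ContinuousOn (fun z : ℝ × ℂ => f z.1 p z.2) (Icc 0 1 ×ˢ {η | η.re ≤ c}))
    (hdiff : ∀ s ∈ Icc (0 : ℝ) 1, ∀ Z : ℂ → ℂ, DifferentiableOn ℂ Z U →
      (∀ p ∈ U, (Z p).re ≤ c) → DifferentiableOn ℂ (fun p => f s p (Z p)) U)
    (hM : ∀ s ∈ Icc (0 : ℝ) 1, ∀ p ∈ U, ∀ η : ℂ, η.re ≤ c → ‖f s p η‖ ≤ M)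
    (hLip : ∀ s ∈ Icc (0 : ℝ) 1, ∀ p ∈ U, ∀ η η' : ℂ, η.re ≤ c → η'.re ≤ c →
      ‖f s p η - f s p η'‖ ≤ K * ‖η - η'‖)
    (hre : ∀ s ∈ Icc (0 : ℝ) 1, ∀ p ∈ U, ∀ η : ℂ, η.re ≤ c → (f s p η).re ≤ 0) :
    ∃ Y : ℝ → ℂ → ℂ,
      (∀ p ∈ U, Y 0 p = c ∧ ∀ s ∈ Icc (0 : ℝ) 1, (Y s p).re ≤ c ∧
        HasDerivWithinAt (fun t => Y t p) (f s p (Y s p)) (Icc 0 1) s) ∧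
      (∀ s ∈ Icc (0 : ℝ) 1, DifferentiableOn ℂ (Y s) U) ∧
      (∀ p ∈ U, (∀ s ∈ Icc (0 : ℝ) 1, ∀ η : ℂ, η.re ≤ c → η.im = 0 → (f s p η).im = 0) →
        ∀ s ∈ Icc (0 : ℝ) 1, (Y s p).im = 0) := by
  set Z := picardIterate f c with hZ
  have hcomp : ∀ p ∈ U, ∀ y : ℝ → ℂ, ContinuousOn y (Icc 0 1) → (∀ s ∈ Icc (0 : ℝ) 1, (y s).re ≤ c) →
      ContinuousOn (fun t => f t p (y t)) (Icc 0 1) := fun p hp y hy hyc =>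
    (hcont p hp).comp (continuousOn_id.prodMk hy) fun t ht => ⟨ht, hyc t ht⟩
  have hint : ∀ y : ℝ → ℂ, ContinuousOn y (Icc 0 1) → ∀ s ∈ Icc (0 : ℝ) 1,
      IntervalIntegrable y MeasureTheory.volume 0 s := by
    intro y hy s hs
    refine ContinuousOn.intervalIntegrable ?_
    rw [uIcc_of_le hs.1]
    exact hy.mono (Icc_subset_Icc_right hs.2)
  have hderiv : ∀ y : ℝ → ℂ, ContinuousOn y (Icc 0 1) → ∀ s ∈ Icc (0 : ℝ) 1,
      HasDerivWithinAt (fun s => (c : ℂ) + ∫ t in (0 : ℝ)..s, y t) (y s) (Icc 0 1) s := by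
    intro y hy s hs
    have : Fact (s ∈ Icc (0 : ℝ) 1) := ⟨hs⟩
    refine HasDerivWithinAt.const_add _ ?_
    refine intervalIntegral.integral_hasDerivWithinAt_right (hint y hy s hs)
      (t := Icc 0 1) ?_ (hy s hs)
    exact (hy.stronglyMeasurableAtFilter_nhdsWithin measurableSet_Icc s)
  have hbase : ∀ n, (∀ p ∈ U, ContinuousOn (fun s => Z n s p) (Icc 0 1)) ∧
      (∀ s ∈ Icc (0 : ℝ) 1, DifferentiableOn ℂ (Z n s) U) ∧
      (∀ s ∈ Icc (0 : ℝ) 1, ∀ p ∈ U, (Z n s p).re ≤ c) := by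
    intro n
    induction n with
    | zero =>
      refine ⟨fun p _ => ?_, fun s _ => ?_, fun s _ p _ => ?_⟩
      · exact continuousOn_const
      · exact differentiableOn_const _
      · simp [hZ, picardIterate]
    | succ n ih =>
      obtain ⟨ih1, ih2, ih3⟩ := ih
      have hc' : ∀ p ∈ U, ContinuousOn (fun t => f t p (Z n t p)) (Icc 0 1) := fun p hp =>
        hcomp p hp _ (ih1 p hp) fun s hs => ih3 s hs p hp
      refine ⟨fun p hp s hs => (hderiv _ (hc' p hp) s hs).continuousWithinAt,
        fun s hs => ?_, fun s hs p hp => ?_⟩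
      · refine (differentiableOn_const (c : ℂ)).add ?_
        have hss : Icc 0 s ⊆ Icc (0 : ℝ) 1 := Icc_subset_Icc_right hs.2
        exact differentiableOn_intervalIntegral_of_bounded (M := M) hU hs.1
          (fun p hp => (hc' p hp).mono hss)
          (fun t ht => hdiff t (hss ht) _ (ih2 t (hss ht)) (ih3 t (hss ht)))
          (fun t ht p hp => hM t (hss ht) p hp _ (ih3 t (hss ht) p hp))
      · have h1 : (∫ t in (0 : ℝ)..s, f t p (Z n t p)).re
            = ∫ t in (0 : ℝ)..s, (f t p (Z n t p)).re :=
          (Complex.reCLM.intervalIntegral_comp_comm (hint _ (hc' p hp) s hs)).symm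
        have h2 : ∫ t in (0 : ℝ)..s, (f t p (Z n t p)).re ≤ 0 := by
          rw [← neg_nonneg, ← intervalIntegral.integral_neg]
          refine intervalIntegral.integral_nonneg hs.1 fun t ht => ?_
          have ht' : t ∈ Icc (0 : ℝ) 1 := ⟨ht.1, ht.2.trans hs.2⟩
          linarith [hre t ht' p hp _ (ih3 t ht' p hp)]
        change ((c : ℂ) + ∫ t in (0 : ℝ)..s, f t p (Z n t p)).re ≤ c
        rw [Complex.add_re, Complex.ofReal_re, h1]
        linarith
  have hfc : ∀ n, ∀ p ∈ U, ContinuousOn (fun t => f t p (Z n t p)) (Icc 0 1) := fun n p hp =>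
    hcomp p hp _ ((hbase n).1 p hp) fun s hs => (hbase n).2.2 s hs p hp
  -- differences of iterates, in the weight `exp (2 K s)`
  have hdist : ∀ n, ∀ s ∈ Icc (0 : ℝ) 1, ∀ p ∈ U,
      ‖Z n s p - Z (n + 1) s p‖ ≤ M * (1 / 2) ^ n * Real.exp (2 * K * s) := by
    intro n
    induction n with
    | zero =>
      intro s hs p hp
      have h1 : ‖∫ t in (0 : ℝ)..s, f t p (Z 0 t p)‖ ≤ M * |s - 0| := by
        refine intervalIntegral.norm_integral_le_of_norm_le_const fun t ht => ?_
        rw [uIoc_of_le hs.1] at ht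
        have ht' : t ∈ Icc (0 : ℝ) 1 := ⟨ht.1.le, ht.2.trans hs.2⟩
        exact hM t ht' p hp _ ((hbase 0).2.2 t ht' p hp)
      have h0 : 0 ≤ M := (norm_nonneg _).trans (hM s hs p hp c (by simp))
      have h2 : Z 0 s p - Z (0 + 1) s p = -∫ t in (0 : ℝ)..s, f t p (Z 0 t p) := by
        change (c : ℂ) - (c + _) = _
        ring
      rw [h2, norm_neg, pow_zero, mul_one]
      refine h1.trans ?_
      rw [sub_zero, abs_of_nonneg hs.1]
      refine mul_le_mul_of_nonneg_left ?_ h0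
      exact hs.2.trans (Real.one_le_exp (by have := hs.1; positivity))
    | succ n ih =>
      intro s hs p hp
      have h0 : 0 ≤ M := (norm_nonneg _).trans (hM s hs p hp c (by simp))
      have h2 : Z (n + 1) s p - Z (n + 1 + 1) s p
          = ∫ t in (0 : ℝ)..s, (f t p (Z n t p) - f t p (Z (n + 1) t p)) := by
        rw [intervalIntegral.integral_sub (hint _ (hfc n p hp) s hs)
          (hint _ (hfc (n + 1) p hp) s hs)]
        change ((c : ℂ) + _) - (c + _) = _
        ring
      rw [h2]
      have h3 : ‖∫ t in (0 : ℝ)..s, (f t p (Z n t p) - f t p (Z (n + 1) t p))‖ ≤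
          ∫ t in (0 : ℝ)..s, K * (M * (1 / 2) ^ n * Real.exp (2 * K * t)) := by
        refine intervalIntegral.norm_integral_le_of_norm_le hs.1
          (Eventually.of_forall fun t ht => ?_) (by
            refine Continuous.intervalIntegrable ?_ _ _
            fun_prop)
        have ht' : t ∈ Icc (0 : ℝ) 1 := ⟨ht.1.le, ht.2.trans hs.2⟩
        refine (hLip t ht' p hp _ _ ((hbase n).2.2 t ht' p hp)
          ((hbase (n + 1)).2.2 t ht' p hp)).trans ?_
        exact mul_le_mul_of_nonneg_left (ih t ht' p hp) hK.le
      have h4 : ∫ t in (0 : ℝ)..s, K * (M * (1 / 2) ^ n * Real.exp (2 * K * t))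
          = M * (1 / 2) ^ (n + 1) * (Real.exp (2 * K * s) - 1) := by
        have hd : ∀ t ∈ uIcc 0 s, HasDerivAt
            (fun t => M * (1 / 2) ^ (n + 1) * Real.exp (2 * K * t))
            (K * (M * (1 / 2) ^ n * Real.exp (2 * K * t))) t := by
          intro t _
          have := (((hasDerivAt_id t).const_mul (2 * K)).exp).const_mul (M * (1 / 2) ^ (n + 1))
          refine this.congr_deriv ?_
          rw [pow_succ, id]
          ring
        rw [intervalIntegral.integral_eq_sub_of_hasDerivAt hd (by
            refine Continuous.intervalIntegrable ?_ _ _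
            fun_prop)]
        simp
        ring
      refine h3.trans (h4.le.trans ?_)
      have : 0 ≤ M * (1 / 2) ^ (n + 1) := by positivity
      nlinarith
  have hdist' : ∀ s ∈ Icc (0 : ℝ) 1, ∀ p ∈ U, ∀ n,
      dist (Z n s p) (Z (n + 1) s p) ≤ (M * Real.exp (2 * K)) * (1 / 2) ^ n := by
    intro s hs p hp n
    have h0 : 0 ≤ M := (norm_nonneg _).trans (hM s hs p hp c (by simp))
    rw [dist_eq_norm]
    refine (hdist n s hs p hp).trans ?_
    have h1 : Real.exp (2 * K * s) ≤ Real.exp (2 * K) := by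
      rw [Real.exp_le_exp]
      nlinarith [hs.2]
    calc M * (1 / 2) ^ n * Real.exp (2 * K * s) ≤ M * (1 / 2) ^ n * Real.exp (2 * K) := by gcongr
      _ = _ := by ring
  have hlim : ∀ s p, ∃ w, s ∈ Icc (0 : ℝ) 1 → p ∈ U → Tendsto (fun n => Z n s p) atTop (𝓝 w) := by
    intro s p
    by_cases h : s ∈ Icc (0 : ℝ) 1 ∧ p ∈ U
    · obtain ⟨w, hw⟩ := cauchySeq_tendsto_of_complete
        (cauchySeq_of_le_geometric (1 / 2) _ (by norm_num) (hdist' s h.1 p h.2))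
      exact ⟨w, fun _ _ => hw⟩
    · exact ⟨0, fun h1 h2 => (h ⟨h1, h2⟩).elim⟩
  choose Y hY using hlim
  have hunif : ∀ n, ∀ s ∈ Icc (0 : ℝ) 1, ∀ p ∈ U,
      dist (Z n s p) (Y s p) ≤ (M * Real.exp (2 * K)) * (1 / 2) ^ n / (1 - 1 / 2) := by
    intro n s hs p hp
    exact dist_le_of_le_geometric_of_tendsto (1 / 2) _ (by norm_num) (hdist' s hs p hp)
      (hY s p hs hp) n
  have hzero : Tendsto (fun n : ℕ => (M * Real.exp (2 * K)) * (1 / 2 : ℝ) ^ n / (1 - 1 / 2))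
      atTop (𝓝 0) := by
    have := ((tendsto_pow_atTop_nhds_zero_of_lt_one (r := (1 / 2 : ℝ)) (by norm_num)
      (by norm_num)).const_mul (M * Real.exp (2 * K))).div_const (1 - 1 / 2)
    simpa using this
  have hYre : ∀ s ∈ Icc (0 : ℝ) 1, ∀ p ∈ U, (Y s p).re ≤ c := fun s hs p hp =>
    le_of_tendsto ((Complex.continuous_re.tendsto _).comp (hY s p hs hp))
      (Eventually.of_forall fun n => (hbase n).2.2 s hs p hp)
  have hYc : ∀ p ∈ U, ContinuousOn (fun s => Y s p) (Icc 0 1) := by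
    intro p hp
    have : TendstoUniformlyOn (fun n s => Z n s p) (fun s => Y s p) atTop (Icc 0 1) := by
      rw [Metric.tendstoUniformlyOn_iff]
      intro ε hε
      filter_upwards [hzero.eventually_lt_const hε] with n hn s hs
      rw [dist_comm]
      exact (hunif n s hs p hp).trans_lt hn
    exact this.continuousOn (Frequently.of_forall fun n => (hbase n).1 p hp)
  have hYeq : ∀ p ∈ U, ∀ s ∈ Icc (0 : ℝ) 1,
      Y s p = c + ∫ t in (0 : ℝ)..s, f t p (Y t p) := by
    intro p hp s hs
    have hfY := hcomp p hp _ (hYc p hp) fun s hs => hYre s hs p hp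
    refine tendsto_nhds_unique ((hY s p hs hp).comp (tendsto_add_atTop_nat 1)) ?_
    rw [tendsto_iff_dist_tendsto_zero]
    have hz := (hzero.const_mul K).mul_const |s - 0|
    rw [mul_zero, zero_mul] at hz
    refine squeeze_zero (fun _ => dist_nonneg) (fun n => ?_) hz
    have h2 : dist (Z (n + 1) s p) (c + ∫ t in (0 : ℝ)..s, f t p (Y t p))
        = ‖∫ t in (0 : ℝ)..s, (f t p (Z n t p) - f t p (Y t p))‖ := by
      rw [intervalIntegral.integral_sub (hint _ (hfc n p hp) s hs) (hint _ hfY s hs),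
        dist_eq_norm]
      congr 1
      change ((c : ℂ) + _) - (c + _) = _
      ring
    simp only [Function.comp]
    rw [h2]
    refine intervalIntegral.norm_integral_le_of_norm_le_const fun t ht => ?_
    rw [uIoc_of_le hs.1] at ht
    have ht' : t ∈ Icc (0 : ℝ) 1 := ⟨ht.1.le, ht.2.trans hs.2⟩
    refine (hLip t ht' p hp _ _ ((hbase n).2.2 t ht' p hp) (hYre t ht' p hp)).trans ?_
    refine mul_le_mul_of_nonneg_left ?_ hK.le
    rw [← dist_eq_norm]
    exact hunif n t ht' p hp
  refine ⟨Y, fun p hp => ⟨?_, fun s hs => ⟨hYre s hs p hp, ?_⟩⟩, fun s hs => ?_,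
    fun p hp him s hs => ?_⟩
  · rw [hYeq p hp 0 (by simp)]
    simp
  · have hfY := hcomp p hp _ (hYc p hp) fun s hs => hYre s hs p hp
    exact (hderiv _ hfY s hs).congr (fun t ht => hYeq p hp t ht) (hYeq p hp s hs)
  · have : TendstoLocallyUniformlyOn (fun n => Z n s) (Y s) atTop U := by
      refine TendstoUniformlyOn.tendstoLocallyUniformlyOn ?_
      rw [Metric.tendstoUniformlyOn_iff]
      intro ε hε
      filter_upwards [hzero.eventually_lt_const hε] with n hn p hp
      rw [dist_comm]
      exact (hunif n s hs p hp).trans_lt hn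
    exact this.differentiableOn (Eventually.of_forall fun n => (hbase n).2.1 s hs) hU
  · have h1 : ∀ n, ∀ s ∈ Icc (0 : ℝ) 1, (Z n s p).im = 0 := by
      intro n
      induction n with
      | zero =>
        intro s _
        simp [hZ, picardIterate]
      | succ n ih =>
        intro s hs
        have h1 : (∫ t in (0 : ℝ)..s, f t p (Z n t p)).im
            = ∫ t in (0 : ℝ)..s, (f t p (Z n t p)).im :=
          (Complex.imCLM.intervalIntegral_comp_comm (hint _ (hfc n p hp) s hs)).symm
        change ((c : ℂ) + ∫ t in (0 : ℝ)..s, f t p (Z n t p)).im = 0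
        rw [Complex.add_im, Complex.ofReal_im, zero_add, h1]
        refine intervalIntegral.integral_zero_ae (Eventually.of_forall fun t ht => ?_)
        rw [uIoc_of_le hs.1] at ht
        have ht' : t ∈ Icc (0 : ℝ) 1 := ⟨ht.1.le, ht.2.trans hs.2⟩
        exact him t ht' _ ((hbase n).2.2 t ht' p hp) (ih t ht')
    exact tendsto_nhds_unique ((Complex.continuous_im.tendsto _).comp (hY s p hs hp))
      (tendsto_const_nhds.congr fun n => (h1 n s hs).symm)

/-- Two solutions on `[0, T]` of the same equation, Lipschitz along a set containing both, agree if
they have the same initial value. -/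
theorem eqOn_of_solutions {T K : ℝ} {V : Set ℂ} {F : ℝ → ℂ → ℂ}
    (hF : ∀ t ∈ Icc 0 T, ∀ η ∈ V, ∀ η' ∈ V, ‖F t η - F t η'‖ ≤ K * ‖η - η'‖)
    {y z : ℝ → ℂ} (hy : ∀ t ∈ Icc 0 T, y t ∈ V ∧ HasDerivWithinAt y (F t (y t)) (Icc 0 T) t)
    (hz : ∀ t ∈ Icc 0 T, z t ∈ V ∧ HasDerivWithinAt z (F t (z t)) (Icc 0 T) t)
    (h0 : y 0 = z 0) : EqOn y z (Icc 0 T) := by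
  have hd : ∀ t ∈ Icc 0 T,
      HasDerivWithinAt (y - z) (F t (y t) - F t (z t)) (Icc 0 T) t := fun t ht =>
    (hy t ht).2.sub (hz t ht).2
  have key := eq_zero_of_abs_deriv_le_mul_abs_self_of_eq_zero_right (f := y - z)
    (f' := fun t => F t (y t) - F t (z t)) (K := K) (a := 0) (b := T)
    (fun t ht => (hd t ht).continuousWithinAt)
    (fun t ht => (hd t (Ico_subset_Icc_self ht)).mono_of_mem_nhdsWithin
      (Icc_mem_nhdsGE_of_mem ht)) (by simp [h0])
    (fun t ht => hF t (Ico_subset_Icc_self ht) _ (hy t (Ico_subset_Icc_self ht)).1 _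
      (hz t (Ico_subset_Icc_self ht)).1)
  intro t ht
  exact sub_eq_zero.1 (key t ht)

/-! ### Analytic continuation along an arc -/

/-- Whether two analytic germs at `z₀` agree can be read off at all points close to `z₀`. -/
theorem eventually_eventuallyEq_iff {f g : ℂ → ℂ} {z₀ : ℂ} (hf : AnalyticAt ℂ f z₀)
    (hg : AnalyticAt ℂ g z₀) : ∀ᶠ z in 𝓝 z₀, (f =ᶠ[𝓝 z] g ↔ f =ᶠ[𝓝 z₀] g) := by
  rcases (hf.sub hg).eventually_eq_zero_or_eventually_ne_zero with h | h
  · have h' : f =ᶠ[𝓝 z₀] g := h.mono fun z hz => sub_eq_zero.1 hz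
    filter_upwards [h'.eventuallyEq_nhds] with z hz
    exact ⟨fun _ => h', fun _ => hz⟩
  · have h1 : ∀ᶠ z in 𝓝 z₀, ∀ᶠ w in 𝓝 z, w ≠ z₀ → f w - g w ≠ 0 :=
      (eventually_nhdsWithin_iff.1 h).eventually_nhds
    filter_upwards [h1] with z hz
    have aux : ∀ u : ℂ, (∀ᶠ w in 𝓝 u, w ≠ z₀ → f w - g w ≠ 0) → ¬ f =ᶠ[𝓝 u] g := by
      intro u hu hfg
      have h2 : ∀ᶠ w in 𝓝 u, w = z₀ := by
        filter_upwards [hu, hfg] with w hw1 hw2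
        by_contra hne
        exact hw1 hne (sub_eq_zero.2 hw2)
      have h3 : ∀ᶠ w in 𝓝[≠] u, w = z₀ := h2.filter_mono nhdsWithin_le_nhds
      have h4 : u = z₀ := h2.self_of_nhds
      obtain ⟨w, hw1, hw2⟩ := (h3.and self_mem_nhdsWithin).exists
      exact hw2 (hw1.trans h4.symm)
    exact ⟨fun h => (aux z hz h).elim, fun h => (aux z₀ h1.self_of_nhds h).elim⟩

theorem IsArcContinuation.unique {f : ℝ → ℝ} {x : ℝ} {w w' : ℂ}
    (h : IsArcContinuation f x w) (h' : IsArcContinuation f x w') : w = w' := by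
  obtain ⟨F, hF1, hF2, hF3, rfl⟩ := h
  obtain ⟨G, hG1, hG2, hG3, rfl⟩ := h'
  have hpi : (0 : ℝ) ≤ 2 * Real.pi := by positivity
  have hcirc : Continuous fun θ : ℝ => (x : ℂ) * Complex.exp (θ * Complex.I) := by fun_prop
  have key : ∀ θ ∈ Icc 0 (2 * Real.pi), ∀ᶠ θ' : ℝ in 𝓝[Icc 0 (2 * Real.pi)] θ,
      (F θ' =ᶠ[𝓝 (x * Complex.exp (θ' * Complex.I))] G θ' ↔
        F θ =ᶠ[𝓝 (x * Complex.exp (θ * Complex.I))] G θ) := by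
    intro θ hθ
    have h1 := (hcirc.tendsto θ).eventually (eventually_eventuallyEq_iff (hF1 θ hθ) (hG1 θ hθ))
    filter_upwards [hF2 θ hθ, hG2 θ hθ, h1.filter_mono nhdsWithin_le_nhds] with θ' h2 h3 h4
    rw [← h4]
    exact ⟨fun h => (h2.symm.trans h).trans h3, fun h => (h2.trans h).trans h3.symm⟩
  have h0 : F 0 =ᶠ[𝓝 (x * Complex.exp ((0 : ℝ) * Complex.I))] G 0 := by
    have hx : (x : ℂ) * Complex.exp ((0 : ℝ) * Complex.I) = x := by simp
    have h1 := hF1 0 ⟨le_rfl, hpi⟩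
    have h2 := hG1 0 ⟨le_rfl, hpi⟩
    rw [hx] at h1 h2 ⊢
    refine (h1.frequently_eq_iff_eventually_eq h2).1 ?_
    have h3 : Tendsto (fun s : ℝ => (s : ℂ)) (𝓝[≠] x) (𝓝[≠] (x : ℂ)) := by
      refine tendsto_nhdsWithin_of_tendsto_nhds_of_eventually_within _
        ((Complex.continuous_ofReal.tendsto x).mono_left nhdsWithin_le_nhds) ?_
      filter_upwards [self_mem_nhdsWithin] with s hs
      exact fun h => hs (Complex.ofReal_injective h)
    refine h3.frequently (Eventually.frequently ?_)
    filter_upwards [hF3.filter_mono nhdsWithin_le_nhds, hG3.filter_mono nhdsWithin_le_nhds]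
      with s hs1 hs2
    rw [hs1, hs2]
  have h2 := isPreconnected_Icc.induction₂
    (fun θ θ' : ℝ => (F θ' =ᶠ[𝓝 (x * Complex.exp (θ' * Complex.I))] G θ' ↔
        F θ =ᶠ[𝓝 (x * Complex.exp (θ * Complex.I))] G θ))
    (fun θ hθ => key θ hθ) (fun _ _ _ _ _ _ h1 h2 => h2.trans h1) (fun _ _ _ _ h => h.symm)
    (⟨le_rfl, hpi⟩ : (0 : ℝ) ∈ Icc 0 (2 * Real.pi)) (⟨hpi, le_rfl⟩ : _ ∈ Icc 0 (2 * Real.pi))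
  have h3 := (h2.2 h0).self_of_nhds
  simpa using h3

/-- A function holomorphic in the logarithmic coordinate, near the segment from `log x` to
`log x + 2 π i`, gives the analytic continuation along the arc. -/
theorem isArcContinuation_of_log {f : ℝ → ℝ} {x : ℝ} (hx : 0 < x) {U : Set ℂ} (hU : IsOpen U)
    {G : ℂ → ℂ} (hG : DifferentiableOn ℂ G U)
    (hseg : ∀ θ ∈ Icc 0 (2 * Real.pi), (Real.log x : ℂ) + θ * Complex.I ∈ U)
    (hf : ∀ᶠ s : ℝ in 𝓝 x, G (Real.log s) = f s) :
    IsArcContinuation f x (G (Real.log x + 2 * Real.pi * Complex.I)) := by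
  have hx0 : (x : ℂ) ≠ 0 := by exact_mod_cast hx.ne'
  set ℓ : ℝ → ℂ → ℂ := fun θ z =>
    (Real.log x : ℂ) + θ * Complex.I + Complex.log (z / (x * Complex.exp (θ * Complex.I))) with hℓ
  have hne : ∀ θ : ℝ, (x : ℂ) * Complex.exp (θ * Complex.I) ≠ 0 := fun θ =>
    mul_ne_zero hx0 (Complex.exp_ne_zero _)
  refine ⟨fun θ z => G (ℓ θ z), fun θ hθ => ?_, fun θ hθ => ?_, ?_, ?_⟩
  · have h1 : ℓ θ (x * Complex.exp (θ * Complex.I)) = Real.log x + θ * Complex.I := by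
      simp [hℓ, div_self (hne θ)]
    refine AnalyticAt.fun_comp (g := G) ?_ ?_
    · rw [h1]
      exact hG.analyticAt (hU.mem_nhds (hseg θ hθ))
    · refine analyticAt_const.add ?_
      refine AnalyticAt.clog (analyticAt_id.div_const) ?_
      rw [div_self (hne θ)]
      exact Complex.one_mem_slitPlane
  · have h1 : ∀ᶠ θ' : ℝ in 𝓝[Icc 0 (2 * Real.pi)] θ, |θ' - θ| < 1 := by
      refine Filter.Eventually.filter_mono nhdsWithin_le_nhds ?_
      have : Tendsto (fun θ' : ℝ => |θ' - θ|) (𝓝 θ) (𝓝 |θ - θ|) :=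
        ((continuous_id.sub continuous_const).abs).tendsto θ
      rw [sub_self, abs_zero] at this
      exact this.eventually_lt_const one_pos
    filter_upwards [h1] with θ' hθ'
    have h2 : ∀ᶠ z in 𝓝 ((x : ℂ) * Complex.exp (θ' * Complex.I)),
        z ≠ 0 ∧ |(Complex.log (z / (x * Complex.exp (θ' * Complex.I)))).im| < 1 := by
      refine (eventually_ne_nhds (hne θ')).and ?_
      have h3 : ContinuousAt (fun z : ℂ =>
          |(Complex.log (z / (x * Complex.exp (θ' * Complex.I)))).im|)
          (x * Complex.exp (θ' * Complex.I)) := by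
        refine ContinuousAt.abs (Complex.continuous_im.continuousAt.comp ?_)
        refine ContinuousAt.clog (continuousAt_id.div_const _) ?_
        rw [div_self (hne θ')]
        exact Complex.one_mem_slitPlane
      have h4 := h3.tendsto
      rw [div_self (hne θ'), Complex.log_one, Complex.zero_im, abs_zero] at h4
      exact h4.eventually_lt_const one_pos
    filter_upwards [h2] with z ⟨hz0, hz⟩
    congr 1
    -- both logarithms have the same exponential, and small imaginary parts
    have h5 : z / (x * Complex.exp (θ * Complex.I)) = Complex.exp
        (Complex.log (z / (x * Complex.exp (θ' * Complex.I))) + (θ' - θ) * Complex.I) := by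
      rw [Complex.exp_add, Complex.exp_log (div_ne_zero hz0 (hne θ')), sub_mul, Complex.exp_sub]
      field_simp [Complex.exp_ne_zero]
    have h6 := Real.pi_gt_three
    rw [abs_lt] at hz hθ'
    have h7 : (Complex.log (z / (x * Complex.exp (θ' * Complex.I))) + (θ' - θ) * Complex.I).im
        = (Complex.log (z / (x * Complex.exp (θ' * Complex.I)))).im + (θ' - θ) := by
      simp
    simp only [hℓ]
    rw [h5, Complex.log_exp (by rw [h7]; linarith) (by rw [h7]; linarith)]
    ring
  · filter_upwards [hf, eventually_gt_nhds hx] with s hs hs0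
    rw [← hs]
    congr 1
    have h8 : (s : ℂ) / (x * Complex.exp ((0 : ℝ) * Complex.I)) = ((s / x : ℝ) : ℂ) := by
      push_cast
      simp
    simp only [hℓ]
    rw [h8, ← Complex.ofReal_log (by positivity), Real.log_div hs0.ne' hx.ne']
    push_cast
    ring
  · have h9 : (x : ℂ) / (x * Complex.exp ((2 * Real.pi : ℝ) * Complex.I)) = 1 := by
      push_cast
      rw [Complex.exp_two_pi_mul_I, mul_one, div_self hx0]
    simp only [hℓ]
    rw [h9, Complex.log_one]
    push_cast
    simp

/-! ### A single foliation of the family -/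

/-- One foliation `x (1 + a) dy + α y (1 + b) dx = 0`: its real coefficients `a`, `b` together with
their complexifications `A`, `B`, regarded as functions on `ℂ × ℂ`. Exchanging the coordinates
gives an object of the same kind, which the definition of `Family` does not allow directly, as the
complexifications there are chosen. -/
structure Saddle where
  α : ℝ
  a : ℝ × ℝ → ℝ
  b : ℝ × ℝ → ℝ
  A : ℂ × ℂ → ℂ
  B : ℂ × ℂ → ℂ

namespace Saddle

variable (X : Saddle)

/-- The coefficients are holomorphic and small on the polydisc of radius `R`, and `A`, `B` extend
`a`, `b`. The bound `1 / 10` makes `(1 + B) / (1 + A)` differ from `1` by at most `1 / 4`. -/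
structure IsRegular (R : ℝ) : Prop where
  α_pos : 0 < X.α
  differentiableOn_A : DifferentiableOn ℂ X.A (Metric.ball 0 R)
  differentiableOn_B : DifferentiableOn ℂ X.B (Metric.ball 0 R)
  norm_A : ∀ p ∈ Metric.ball (0 : ℂ × ℂ) R, ‖X.A p‖ ≤ 1 / 10
  norm_B : ∀ p ∈ Metric.ball (0 : ℂ × ℂ) R, ‖X.B p‖ ≤ 1 / 10
  A_ofReal : ∀ x y : ℝ, |x| < R → |y| < R → X.A (x, y) = X.a (x, y)
  B_ofReal : ∀ x y : ℝ, |x| < R → |y| < R → X.B (x, y) = X.b (x, y)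

/-- The complex one-form of the foliation. -/
def form (p v : ℂ × ℂ) : ℂ :=
  p.1 * (1 + X.A (p.1, p.2)) * v.2 + (X.α : ℂ) * p.2 * (1 + X.B (p.1, p.2)) * v.1

/-- A differentiable path in a leaf, inside the polydisc of radius `r`. -/
def IsLeafPath (r T : ℝ) (γ : ℝ → ℂ × ℂ) : Prop :=
  ∀ t ∈ Icc 0 T, ‖(γ t).1‖ < r ∧ ‖(γ t).2‖ < r ∧ γ t ≠ 0 ∧
    ∃ v, HasDerivWithinAt γ v (Icc 0 T) t ∧ X.form (γ t) v = 0

/-- The holonomy relation of the separatrix `{y = 0}` on the cross-section `{x = c}`. -/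
def IsHolonomy (r c : ℝ) (w w' : ℂ) : Prop :=
  ∃ γ : ℝ → ℂ × ℂ, X.IsLeafPath r (2 * Real.pi) γ ∧
    (∀ θ ∈ Icc 0 (2 * Real.pi), (γ θ).1 = c * Complex.exp (θ * Complex.I)) ∧
    (γ 0).2 = w ∧ (γ (2 * Real.pi)).2 = w'

/-- The Dulac relation: an orbit in the open first quadrant goes from `(x, c₁)` to `(c₂, y)`. -/
def IsDulac (r c₁ c₂ x y : ℝ) : Prop :=
  ∃ (T : ℝ) (u v : ℝ → ℝ), 0 ≤ T ∧
    (∀ t ∈ Icc 0 T, u t ∈ Ioo 0 r ∧ v t ∈ Ioo 0 r ∧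
      HasDerivWithinAt u (u t * (1 + X.a (u t, v t))) (Icc 0 T) t ∧
      HasDerivWithinAt v (-(X.α * v t * (1 + X.b (u t, v t)))) (Icc 0 T) t) ∧
    u 0 = x ∧ v 0 = c₁ ∧ u T = c₂ ∧ v T = y

/-- The slope function: the leaves are the solutions of `dy / dx = -α (y / x) q(x, y)`. -/
def q (p : ℂ × ℂ) : ℂ := (1 + X.B p) / (1 + X.A p)

/-- The slope in logarithmic coordinates: the leaves are the solutions of `dη / dζ = h(ζ, η)`,
where `x = exp ζ` and `y = exp η`. -/
def h (ζ η : ℂ) : ℂ := -(X.α * X.q (Complex.exp ζ, Complex.exp η))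

variable {X} {R r : ℝ}

theorem IsRegular.one_add_A_ne_zero (hX : X.IsRegular R) {p : ℂ × ℂ}
    (hp : p ∈ Metric.ball 0 R) : 1 + X.A p ≠ 0 := by
  intro h0
  have h1 : X.A p = -1 := by linear_combination h0
  have h2 := hX.norm_A p hp
  rw [h1] at h2
  norm_num at h2

theorem IsRegular.norm_q_sub_one (hX : X.IsRegular R) {p : ℂ × ℂ}
    (hp : p ∈ Metric.ball 0 R) : ‖X.q p - 1‖ ≤ 1 / 4 := by
  have h0 := hX.one_add_A_ne_zero hp
  have h1 : X.q p - 1 = (X.B p - X.A p) / (1 + X.A p) := by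
    rw [q]; field_simp; ring
  have hA := hX.norm_A p hp
  have hB := hX.norm_B p hp
  have h2 : ‖X.B p - X.A p‖ ≤ 1 / 5 := (norm_sub_le _ _).trans (by linarith)
  have h3 : 9 / 10 ≤ ‖1 + X.A p‖ := by
    have := norm_sub_le (1 + X.A p) (X.A p)
    rw [add_sub_cancel_right, norm_one] at this
    linarith
  rw [h1, norm_div, div_le_iff₀ (by linarith)]
  linarith

theorem IsRegular.norm_q (hX : X.IsRegular R) {p : ℂ × ℂ}
    (hp : p ∈ Metric.ball 0 R) : ‖X.q p‖ ≤ 5 / 4 := by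
  have h1 := norm_add_le (X.q p - 1) 1
  rw [sub_add_cancel, norm_one] at h1
  linarith [hX.norm_q_sub_one hp]

theorem IsRegular.differentiableOn_q (hX : X.IsRegular R) :
    DifferentiableOn ℂ X.q (Metric.ball 0 R) := by
  have h1 : DifferentiableOn ℂ (fun p => (1 + X.B p) * (1 + X.A p)⁻¹) (Metric.ball 0 R) :=
    ((differentiableOn_const 1).add hX.differentiableOn_B).mul
      (((differentiableOn_const 1).add hX.differentiableOn_A).inv
        fun _ hp => hX.one_add_A_ne_zero hp)
  exact h1

theorem mem_ball_prod {x y : ℂ} (hx : ‖x‖ < R) (hy : ‖y‖ < R) :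
    (x, y) ∈ Metric.ball (0 : ℂ × ℂ) R := by
  rw [mem_ball_zero_iff, Prod.norm_def]
  exact max_lt hx hy

/-- By the Cauchy estimate, `q` is Lipschitz in `y` on a smaller polydisc. -/
theorem IsRegular.exists_lipschitz_q (hX : X.IsRegular R) (hrR : r < R) :
    ∃ K : ℝ, 0 ≤ K ∧ ∀ x y y' : ℂ, ‖x‖ < r → ‖y‖ < r → ‖y'‖ < r →
      ‖X.q (x, y) - X.q (x, y')‖ ≤ K * ‖y - y'‖ := by
  refine ⟨5 / 4 / ((R - r) / 2), div_nonneg (by norm_num) (by linarith),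
    fun x y y' hx hy hy' => ?_⟩
  have hδ : 0 < (R - r) / 2 := by linarith
  have hd : DifferentiableOn ℂ (fun y => X.q (x, y)) (Metric.ball 0 R) :=
    hX.differentiableOn_q.comp (by fun_prop) fun z hz =>
      mem_ball_prod (hx.trans hrR) (mem_ball_zero_iff.1 hz)
  have hball : ∀ z ∈ Metric.ball (0 : ℂ) r,
      Metric.closedBall z ((R - r) / 2) ⊆ Metric.ball 0 R := by
    intro z hz w hw
    have := dist_triangle w z 0
    simp only [Metric.mem_ball, Metric.mem_closedBall] at *
    linarith
  refine Convex.norm_image_sub_le_of_norm_deriv_le (f := fun y => X.q (x, y))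
    (s := Metric.ball 0 r) (𝕜 := ℂ) (fun z hz => ?_) (fun z hz => ?_) (convex_ball 0 r)
    (mem_ball_zero_iff.2 hy') (mem_ball_zero_iff.2 hy)
  · exact hd.differentiableAt (Metric.isOpen_ball.mem_nhds
      (hball z hz (Metric.mem_closedBall_self hδ.le)))
  · refine Complex.norm_deriv_le_of_forall_mem_sphere_norm_le hδ
      ((hd.mono (hball z hz)).diffContOnCl_ball subset_rfl) fun w hw => ?_
    exact hX.norm_q (mem_ball_prod (hx.trans hrR)
      (mem_ball_zero_iff.1 (hball z hz (Metric.sphere_subset_closedBall hw))))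

theorem norm_exp_lt (hr : 0 < r) {ζ : ℂ} (hζ : ζ.re < Real.log r) : ‖Complex.exp ζ‖ < r := by
  rw [Complex.norm_exp, ← Real.lt_log_iff_exp_lt hr]
  exact hζ

theorem IsRegular.exists_lipschitz_h (hX : X.IsRegular R) (hr : 0 < r) (hrR : r < R) :
    ∃ K : ℝ, 0 ≤ K ∧ ∀ ζ η η' : ℂ, ζ.re < Real.log r → η.re < Real.log r → η'.re < Real.log r →
      ‖X.h ζ η - X.h ζ η'‖ ≤ K * ‖η - η'‖ := by
  obtain ⟨K, hK, hq⟩ := hX.exists_lipschitz_q hrR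
  have hα := hX.α_pos
  refine ⟨X.α * (K * r), by positivity, fun ζ η η' hζ hη hη' => ?_⟩
  have h1 : ‖Complex.exp η - Complex.exp η'‖ ≤ r * ‖η - η'‖ := by
    refine Convex.norm_image_sub_le_of_norm_deriv_le (s := {z : ℂ | z.re < Real.log r})
      (fun z _ => Complex.differentiableAt_exp) (fun z hz => ?_)
      (convex_halfSpace_re_lt _) hη' hη
    rw [Complex.deriv_exp]
    exact (norm_exp_lt hr hz).le
  have h2 : X.h ζ η - X.h ζ η' = -(X.α * (X.q (Complex.exp ζ, Complex.exp η) -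
      X.q (Complex.exp ζ, Complex.exp η'))) := by
    simp only [h]; ring
  rw [h2, norm_neg, norm_mul, Complex.norm_real, Real.norm_of_nonneg hα.le]
  calc X.α * _ ≤ X.α * (K * (r * ‖η - η'‖)) := by
        gcongr
        exact (hq _ _ _ (norm_exp_lt hr hζ) (norm_exp_lt hr hη) (norm_exp_lt hr hη')).trans
          (by gcongr)
    _ = _ := by ring

theorem IsRegular.q_im (hX : X.IsRegular R) {x y : ℝ} (hx : |x| < R) (hy : |y| < R) :
    (X.q (x, y)).im = 0 := by
  rw [q, hX.A_ofReal x y hx hy, hX.B_ofReal x y hx hy]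
  have : (1 + (X.b (x, y) : ℂ)) / (1 + (X.a (x, y) : ℂ))
      = (((1 + X.b (x, y)) / (1 + X.a (x, y)) : ℝ) : ℂ) := by push_cast; rfl
  rw [this, Complex.ofReal_im]

theorem IsRegular.abs_a_le (hX : X.IsRegular R) {x y : ℝ} (hx : |x| < R) (hy : |y| < R) :
    |X.a (x, y)| ≤ 1 / 10 := by
  have := hX.norm_A (x, y) (mem_ball_prod (by rwa [Complex.norm_real])
    (by rwa [Complex.norm_real]))
  rwa [hX.A_ofReal x y hx hy, Complex.norm_real] at this

/-! ### Transport along segments in the logarithmic coordinate -/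

variable (X) in
/-- `y` is the lift of the segment `ζ + s v`, `0 ≤ s ≤ 1`, to a leaf, in logarithmic coordinates,
with initial value `η₀`, inside the region `Re η < log r`. -/
structure IsLift (r : ℝ) (η₀ ζ v : ℂ) (y : ℝ → ℂ) : Prop where
  init : y 0 = η₀
  re_lt : ∀ s ∈ Icc (0 : ℝ) 1, (y s).re < Real.log r
  hasDeriv : ∀ s ∈ Icc (0 : ℝ) 1,
    HasDerivWithinAt y (v * X.h (ζ + s * v) (y s)) (Icc 0 1) s

theorem segment_re_lt {ζ v : ℂ} {s l : ℝ} (hs : s ∈ Icc (0 : ℝ) 1) (h0 : ζ.re < l)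
    (h1 : (ζ + v).re < l) : (ζ + s * v).re < l := by
  simp only [Complex.add_re, Complex.re_ofReal_mul] at *
  obtain ⟨hs0, hs1⟩ := hs
  rcases hs0.eq_or_lt with rfl | hs0
  · simpa using h0
  · nlinarith

/-- Lifts are unique; the starting point `ζ` matters only modulo `2 π i`. -/
theorem IsLift.eqOn (hX : X.IsRegular R) (hr : 0 < r) (hrR : r < R) {η₀ ζ ζ' v : ℂ} {y z : ℝ → ℂ}
    (h0 : ζ.re < Real.log r) (h1 : (ζ + v).re < Real.log r)
    (hζ : Complex.exp ζ = Complex.exp ζ')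
    (hy : X.IsLift r η₀ ζ v y) (hz : X.IsLift r η₀ ζ' v z) : EqOn y z (Icc 0 1) := by
  obtain ⟨K, -, hh⟩ := hX.exists_lipschitz_h hr hrR
  have hper : ∀ (s : ℝ) η, X.h (ζ' + s * v) η = X.h (ζ + s * v) η := by
    intro s η
    simp only [h, Complex.exp_add, hζ]
  refine eqOn_of_solutions (K := ‖v‖ * K) (V := {η | η.re < Real.log r})
    (F := fun s η => v * X.h (ζ + s * v) η) (fun s hs η hη η' hη' => ?_)
    (fun s hs => ⟨hy.re_lt s hs, hy.hasDeriv s hs⟩)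
    (fun s hs => ⟨hz.re_lt s hs, by rw [← hper]; exact hz.hasDeriv s hs⟩)
    (hy.init.trans hz.init.symm)
  rw [← mul_sub, norm_mul, mul_assoc]
  gcongr
  exact hh _ _ _ (segment_re_lt hs h0 h1) hη hη'

/-- The segments of direction `v` with `|Im v| ≤ Re v` lift: the real part of `v h` is nonpositive
there, so that `|y| = exp (Re η)` decreases along the lift. The lift is holomorphic in parameters
and real over real segments. -/
theorem IsRegular.exists_lift (hX : X.IsRegular R) (hr : 0 < r) (hrR : r < R) {c : ℝ}
    (hc : c < Real.log r) {U : Set ℂ} (hU : IsOpen U) {m : ℝ} {ζ v : ℂ → ℂ}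
    (hζd : DifferentiableOn ℂ ζ U) (hvd : DifferentiableOn ℂ v U)
    (hv : ∀ p ∈ U, |(v p).im| ≤ (v p).re ∧ (v p).re ≤ m)
    (h0 : ∀ p ∈ U, (ζ p).re < Real.log r) (h1 : ∀ p ∈ U, (ζ p + v p).re < Real.log r) :
    ∃ Y : ℝ → ℂ → ℂ, (∀ p ∈ U, X.IsLift r c (ζ p) (v p) (fun s => Y s p)) ∧
      (∀ p ∈ U, (Y 1 p).re ≤ c) ∧ DifferentiableOn ℂ (Y 1) U ∧
      (∀ p ∈ U, (ζ p).im = 0 → (v p).im = 0 → ∀ s ∈ Icc (0 : ℝ) 1, (Y s p).im = 0) := by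
  obtain ⟨K, hK, hh⟩ := hX.exists_lipschitz_h hr hrR
  have hα := hX.α_pos
  have hseg : ∀ s ∈ Icc (0 : ℝ) 1, ∀ p ∈ U, (ζ p + s * v p).re < Real.log r := fun s hs p hp =>
    segment_re_lt hs (h0 p hp) (h1 p hp)
  have hmem : ∀ s ∈ Icc (0 : ℝ) 1, ∀ p ∈ U, ∀ η : ℂ, η.re ≤ c →
      (Complex.exp (ζ p + s * v p), Complex.exp η) ∈ Metric.ball (0 : ℂ × ℂ) R :=
    fun s hs p hp η hη => mem_ball_prod ((norm_exp_lt hr (hseg s hs p hp)).trans hrR)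
      ((norm_exp_lt hr (hη.trans_lt hc)).trans hrR)
  have hvn : ∀ p ∈ U, ‖v p‖ ≤ 2 * (v p).re := fun p hp => by
    have h2 := Complex.norm_le_abs_re_add_abs_im (v p)
    have h3 := (hv p hp).1
    rw [abs_of_nonneg ((abs_nonneg _).trans h3)] at h2
    linarith
  have hvm : ∀ p ∈ U, ‖v p‖ ≤ 2 * |m| := fun p hp => by
    linarith [hvn p hp, (hv p hp).2, le_abs_self m]
  have key := exists_holomorphic_solution (c := c)
    (f := fun s p η => v p * X.h (ζ p + s * v p) η)
    (M := 2 * |m| * (X.α * (5 / 4))) (K := 2 * |m| * K + 1) hU (by positivity)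
    ?_ ?_ ?_ ?_ ?_
  · obtain ⟨Y, hY1, hY2, hY3⟩ := key
    refine ⟨Y, fun p hp => ⟨(hY1 p hp).1, fun s hs => ((hY1 p hp).2 s hs).1.trans_lt hc,
      fun s hs => ((hY1 p hp).2 s hs).2⟩, fun p hp => ((hY1 p hp).2 1 (by simp)).1,
      hY2 1 (by simp), fun p hp hζi hvi => hY3 p hp fun s hs η hη hηi => ?_⟩
    have hz : ∀ z : ℂ, z.im = 0 → z.re < Real.log r →
        ∃ x : ℝ, Complex.exp z = x ∧ |x| < R := by
      intro z hz hzr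
      refine ⟨Real.exp z.re, ?_, ?_⟩
      · conv_lhs => rw [← Complex.re_add_im z, hz]
        push_cast
        simp
      · have := (norm_exp_lt hr hzr).trans hrR
        rwa [Complex.norm_exp, ← Real.abs_exp] at this
    obtain ⟨x₁, hx₁, hx₁R⟩ := hz (ζ p + s * v p) (by simp [hζi, hvi]) (hseg s hs p hp)
    obtain ⟨x₂, hx₂, hx₂R⟩ := hz η hηi (hη.trans_lt hc)
    simp only [h, hx₁, hx₂, Complex.mul_im, Complex.neg_im, Complex.neg_re, Complex.ofReal_im,
      hX.q_im hx₁R hx₂R, hvi]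
    simp
  · intro p hp
    refine continuousOn_const.mul ?_
    refine ((continuousOn_const.mul (hX.differentiableOn_q.continuousOn.comp
      (f := fun z : ℝ × ℂ => (Complex.exp (ζ p + z.1 * v p), Complex.exp z.2)) ?_ ?_))).neg
    · fun_prop
    · exact fun z hz => hmem z.1 hz.1 p hp z.2 hz.2
  · intro s hs Z hZ hZc
    refine hvd.mul (((differentiableOn_const _).mul (hX.differentiableOn_q.comp
      (f := fun p => (Complex.exp (ζ p + s * v p), Complex.exp (Z p))) ?_ ?_))).neg
    · exact (hζd.add (hvd.const_mul _)).cexp.prodMk hZ.cexp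
    · exact fun p hp => hmem s hs p hp _ (hZc p hp)
  · intro s hs p hp η hη
    have h2 := hX.norm_q (hmem s hs p hp η hη)
    rw [norm_mul, h, norm_neg, norm_mul, Complex.norm_real, Real.norm_of_nonneg hα.le]
    have := hvm p hp
    gcongr
  · intro s hs p hp η η' hη hη'
    rw [← mul_sub, norm_mul]
    have h2 := hh _ _ _ (hseg s hs p hp) (hη.trans_lt hc) (hη'.trans_lt hc)
    calc ‖v p‖ * _ ≤ 2 * |m| * (K * ‖η - η'‖) := by
          have := hvm p hp
          gcongr
      _ ≤ _ := by nlinarith [norm_nonneg (η - η')]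
  · intro s hs p hp η hη
    set w := X.q (Complex.exp (ζ p + s * v p), Complex.exp η) with hw
    have h2 : ‖w - 1‖ ≤ 1 / 4 := hX.norm_q_sub_one (hmem s hs p hp η hη)
    have h3 : v p * X.h (ζ p + s * v p) η = (X.α : ℂ) * -(v p + v p * (w - 1)) := by
      simp only [h, ← hw]
      ring
    have h4 : -(v p * (w - 1)).re ≤ 2 * (v p).re * (1 / 4) := by
      refine (neg_le_abs _).trans ((Complex.abs_re_le_norm _).trans ?_)
      rw [norm_mul]
      have h5 := hvn p hp
      have h6 : 0 ≤ 2 * (v p).re := (norm_nonneg _).trans h5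
      gcongr
    have h7 : 0 ≤ (v p).re := (abs_nonneg _).trans (hv p hp).1
    rw [h3, Complex.re_ofReal_mul, Complex.neg_re, Complex.add_re]
    exact mul_nonpos_of_nonneg_of_nonpos hα.le (by linarith)

end Saddle

/-! ### Change of time -/

/-- A positive continuous function on `[0, 1]` is the density `dt / ds` of a change of time: `σ` is
the inverse of the function `s ↦ ∫₀ˢ k`. -/
theorem exists_time_change {k : ℝ → ℝ} (hk : ContinuousOn k (Icc 0 1))
    (hpos : ∀ s ∈ Icc (0 : ℝ) 1, 0 < k s) :
    ∃ (T : ℝ) (σ : ℝ → ℝ), 0 ≤ T ∧ σ 0 = 0 ∧ σ T = 1 ∧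
      ∀ t ∈ Icc 0 T, σ t ∈ Icc (0 : ℝ) 1 ∧ HasDerivWithinAt σ (k (σ t))⁻¹ (Icc 0 T) t := by
  set g : ℝ → ℝ := IccExtend zero_le_one ((Icc (0 : ℝ) 1).domRestrict k) with hg
  have hgc : Continuous g := hk.domRestrict.Icc_extend'
  have hgk : ∀ s ∈ Icc (0 : ℝ) 1, g s = k s := fun s hs => by
    rw [hg, IccExtend_of_mem _ _ hs]; rfl
  have hgI : ∀ s, ∃ s' ∈ Icc (0 : ℝ) 1, g s = k s' := fun s =>
    ⟨projIcc 0 1 zero_le_one s, (projIcc 0 1 zero_le_one s).2, rfl⟩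
  obtain ⟨s₀, hs₀, hmin⟩ := isCompact_Icc.exists_isMinOn (nonempty_Icc.2 zero_le_one) hk
  have hm : 0 < k s₀ := hpos s₀ hs₀
  have hmg : ∀ s, k s₀ ≤ g s := fun s => by
    obtain ⟨s', hs', h⟩ := hgI s
    rw [h]
    exact hmin hs'
  set τ : ℝ → ℝ := fun s => ∫ t in (0 : ℝ)..s, g t with hτ
  have hτd : ∀ s, HasDerivAt τ (g s) s := fun s =>
    intervalIntegral.integral_hasDerivAt_right (hgc.intervalIntegrable _ _)
      (hgc.stronglyMeasurableAtFilter _ _) hgc.continuousAt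
  have hτc : Continuous τ := continuous_iff_continuousAt.2 fun s => (hτd s).continuousAt
  have hτm : StrictMono τ := strictMono_of_deriv_pos fun s => by
    rw [(hτd s).deriv]
    exact hm.trans_le (hmg s)
  have hτ0 : τ 0 = 0 := by simp [hτ]
  have hlin : Monotone fun s => τ s - k s₀ * s := by
    have hd : ∀ s, HasDerivAt (fun s => τ s - k s₀ * s) (g s - k s₀) s := fun s => by
      refine ((hτd s).sub ((hasDerivAt_id s).const_mul (k s₀))).congr_deriv ?_
      rw [mul_one]
    refine monotone_of_deriv_nonneg (fun s => (hd s).differentiableAt) fun s => ?_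
    rw [(hd s).deriv]
    linarith [hmg s]
  have htop : Tendsto τ atTop atTop := by
    refine tendsto_atTop_mono' _ ?_ (tendsto_id.const_mul_atTop hm)
    filter_upwards [eventually_ge_atTop 0] with s hs
    have := hlin hs
    simp only [hτ0, mul_zero, sub_zero] at this
    simp only [id]
    linarith
  have hbot : Tendsto τ atBot atBot := by
    refine tendsto_atBot_mono' _ ?_ (tendsto_id.const_mul_atBot hm)
    filter_upwards [eventually_le_atBot 0] with s hs
    have := hlin hs
    simp only [hτ0, mul_zero, sub_zero] at this
    simp only [id]
    linarith
  set e := hτm.orderIsoOfSurjective τ (hτc.surjective htop hbot) with he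
  have hes : ∀ s, e.symm (τ s) = s := fun s => e.symm_apply_apply s
  have hse : ∀ t, τ (e.symm t) = t := fun t => e.apply_symm_apply t
  have h0 : e.symm 0 = 0 := by
    have := hes 0
    rwa [hτ0] at this
  have hmem : ∀ t ∈ Icc 0 (τ 1), e.symm t ∈ Icc (0 : ℝ) 1 := fun t ht => by
    constructor
    · rw [← h0]
      exact e.symm.monotone ht.1
    · rw [← hes 1]
      exact e.symm.monotone ht.2
  refine ⟨τ 1, e.symm, ?_, h0, hes 1, fun t ht => ⟨hmem t ht, ?_⟩⟩
  · rw [← hτ0]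
    exact hτm.monotone zero_le_one
  · rw [← hgk _ (hmem t ht)]
    exact (HasDerivAt.of_local_left_inverse e.symm.continuous.continuousAt (hτd _)
      (hm.trans_le (hmg _)).ne' (Eventually.of_forall hse)).hasDerivWithinAt

namespace Saddle

variable {X : Saddle} {R r : ℝ}

/-! ### The Dulac map and the holonomy map -/

/-- The lift of the segment from `log x` to `log c₂` is the real orbit of `(x, c₁)`, up to a change
of time. -/
theorem IsLift.isDulac (hX : X.IsRegular R) (hr : 0 < r) (hrR : r < R) {c₁ c₂ x : ℝ}
    (hc₁ : 0 < c₁) (hc₂ : 0 < c₂) (hc₂r : c₂ < r) (hx : 0 < x) (hxc : x < c₂) {y : ℝ → ℂ}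
    (hy : X.IsLift r (Real.log c₁) (Real.log x) (Real.log c₂ - Real.log x) y)
    (hreal : ∀ s ∈ Icc (0 : ℝ) 1, (y s).im = 0) :
    X.IsDulac r c₁ c₂ x (Real.exp (y 1).re) := by
  set V := Real.log c₂ - Real.log x with hV
  have hVpos : 0 < V := sub_pos.2 (Real.log_lt_log hx hxc)
  have hlr : Real.log c₂ < Real.log r := Real.log_lt_log hc₂ hc₂r
  set u : ℝ → ℝ := fun s => Real.exp (Real.log x + s * V) with hu
  set w : ℝ → ℝ := fun s => Real.exp (y s).re with hw
  have hur : ∀ s ∈ Icc (0 : ℝ) 1, u s ∈ Ioo 0 r := fun s hs => by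
    refine ⟨Real.exp_pos _, ?_⟩
    rw [hu, ← Real.lt_log_iff_exp_lt hr]
    have := mul_le_of_le_one_left hVpos.le hs.2
    rw [hV] at *
    linarith
  have hwr : ∀ s ∈ Icc (0 : ℝ) 1, w s ∈ Ioo 0 r := fun s hs =>
    ⟨Real.exp_pos _, by
      rw [hw, ← Real.lt_log_iff_exp_lt hr]
      exact hy.re_lt s hs⟩
  have hexp_u : ∀ s : ℝ, Complex.exp ((Real.log x : ℂ) + s * ((Real.log c₂ : ℂ) - Real.log x))
      = u s := fun s => by
    rw [hu, hV]; push_cast; rfl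
  have hexp_w : ∀ s ∈ Icc (0 : ℝ) 1, Complex.exp (y s) = w s := fun s hs => by
    rw [hw]
    conv_lhs => rw [← Complex.re_add_im (y s), hreal s hs]
    simp
  have hab : ∀ s ∈ Icc (0 : ℝ) 1, |u s| < R ∧ |w s| < R := fun s hs => by
    rw [abs_of_pos (hur s hs).1, abs_of_pos (hwr s hs).1]
    exact ⟨(hur s hs).2.trans hrR, (hwr s hs).2.trans hrR⟩
  have ha : ∀ s ∈ Icc (0 : ℝ) 1, 0 < 1 + X.a (u s, w s) := fun s hs => by
    have := (abs_le.1 (hX.abs_a_le (hab s hs).1 (hab s hs).2)).1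
    linarith
  have hyc : ContinuousOn y (Icc 0 1) := fun s hs => (hy.hasDeriv s hs).continuousWithinAt
  have hwc : ContinuousOn w (Icc 0 1) :=
    Real.continuous_exp.comp_continuousOn (Complex.continuous_re.comp_continuousOn hyc)
  have huc : Continuous u := by fun_prop
  have hac : ContinuousOn (fun s => X.a (u s, w s)) (Icc 0 1) := by
    have h1 : ContinuousOn (fun s => (X.A (u s, w s)).re) (Icc 0 1) := by
      refine Complex.continuous_re.comp_continuousOn (hX.differentiableOn_A.continuousOn.comp
        (f := fun s => ((u s : ℂ), (w s : ℂ))) ?_ fun s hs => ?_)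
      · exact (Complex.continuous_ofReal.comp huc).continuousOn.prodMk
          (Complex.continuous_ofReal.comp_continuousOn hwc)
      · refine mem_ball_prod ?_ ?_ <;> rw [Complex.norm_real]
        · exact (hab s hs).1
        · exact (hab s hs).2
    refine h1.congr fun s hs => ?_
    simp only
    rw [hX.A_ofReal _ _ (hab s hs).1 (hab s hs).2, Complex.ofReal_re]
  obtain ⟨T, σ, hT, hσ0, hσT, hσ⟩ := exists_time_change (k := fun s => V / (1 + X.a (u s, w s)))
    (continuousOn_const.div (continuousOn_const.add hac) fun s hs => (ha s hs).ne')
    fun s hs => div_pos hVpos (ha s hs)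
  refine ⟨T, u ∘ σ, w ∘ σ, hT, fun t ht => ?_, ?_, ?_, ?_, ?_⟩
  · obtain ⟨hs, hσd⟩ := hσ t ht
    refine ⟨hur _ hs, hwr _ hs, ?_, ?_⟩
    · have h1 : HasDerivAt u (u (σ t) * V) (σ t) := by
        have := (((hasDerivAt_id (σ t)).mul_const V).const_add (Real.log x)).exp
        simpa using this
      refine (h1.comp_hasDerivWithinAt t hσd).congr_deriv ?_
      simp only [Function.comp]
      field_simp
    · have h1 : HasDerivWithinAt (fun s => (y s).re)
          (-(V * X.α * ((1 + X.b (u (σ t), w (σ t))) / (1 + X.a (u (σ t), w (σ t))))))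
          (Icc 0 1) (σ t) := by
        have h2 := Complex.reCLM.hasFDerivAt.comp_hasDerivWithinAt _ (hy.hasDeriv _ hs)
        refine h2.congr_deriv ?_
        rw [h, hexp_u, hexp_w _ hs, q, hX.A_ofReal _ _ (hab _ hs).1 (hab _ hs).2,
          hX.B_ofReal _ _ (hab _ hs).1 (hab _ hs).2]
        have h3 : ((Real.log c₂ : ℂ) - Real.log x) * -((X.α : ℂ) *
            ((1 + (X.b (u (σ t), w (σ t)) : ℂ)) / (1 + (X.a (u (σ t), w (σ t)) : ℂ))))
            = ((-(V * X.α * ((1 + X.b (u (σ t), w (σ t))) /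
              (1 + X.a (u (σ t), w (σ t)))))  : ℝ) : ℂ) := by
          rw [hV]; push_cast; ring
        rw [h3]
        exact Complex.ofReal_re _
      have h4 := h1.exp.comp t hσd fun t' ht' => (hσ t' ht').1
      refine h4.congr_deriv ?_
      have h5 := (ha _ hs).ne'
      have h6 : Real.exp (y (σ t)).re = w (σ t) := rfl
      simp only [Function.comp, h6]
      field_simp
  · simp [hσ0, hu, Real.exp_log hx]
  · simp [hσ0, hw, hy.init, Real.exp_log hc₁]
  · simp [hσT, hu, hV, Real.exp_log hc₂]
  · simp [hσT, hw]

/-- An orbit ends at the same point as the lift: in logarithmic coordinates and as functions of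
time, both solve `η' = (1 + a) h(log u, η)`. -/
theorem IsLift.dulac_unique (hX : X.IsRegular R) (hr : 0 < r) (hrR : r < R) {c₁ c₂ x y' : ℝ}
    (hx : 0 < x) (hxc : x < c₂) {y : ℝ → ℂ}
    (hy : X.IsLift r (Real.log c₁) (Real.log x) (Real.log c₂ - Real.log x) y)
    (hD : X.IsDulac r c₁ c₂ x y') : y' = Real.exp (y 1).re := by
  obtain ⟨T, u, v, hT, huv, hu0, hv0, huT, hvT⟩ := hD
  set V := Real.log c₂ - Real.log x with hV
  have hVpos : 0 < V := sub_pos.2 (Real.log_lt_log hx hxc)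
  have hVne : (V : ℂ) ≠ 0 := by exact_mod_cast hVpos.ne'
  have hVc : (Real.log c₂ : ℂ) - Real.log x = V := by rw [hV]; push_cast; rfl
  obtain ⟨K, hK, hh⟩ := hX.exists_lipschitz_h hr hrR
  have hab : ∀ t ∈ Icc 0 T, |u t| < R ∧ |v t| < R := fun t ht => by
    obtain ⟨h1, h2, -⟩ := huv t ht
    rw [abs_of_pos h1.1, abs_of_pos h2.1]
    exact ⟨h1.2.trans hrR, h2.2.trans hrR⟩
  have ha : ∀ t ∈ Icc 0 T, |X.a (u t, v t)| ≤ 1 / 10 := fun t ht =>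
    hX.abs_a_le (hab t ht).1 (hab t ht).2
  have hmono : MonotoneOn u (Icc 0 T) := by
    refine monotoneOn_of_hasDerivWithinAt_nonneg (convex_Icc 0 T)
      (fun t ht => (huv t ht).2.2.1.continuousWithinAt)
      (fun t ht => (huv t (interior_subset ht)).2.2.1.mono interior_subset) fun t ht => ?_
    have ht' := interior_subset ht
    have := (abs_le.1 (ha t ht')).1
    exact mul_nonneg (huv t ht').1.1.le (by linarith)
  set s : ℝ → ℝ := fun t => (Real.log (u t) - Real.log x) / V with hs
  have hsI : ∀ t ∈ Icc 0 T, s t ∈ Icc (0 : ℝ) 1 := fun t ht => by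
    have h0 : u 0 ≤ u t := hmono (left_mem_Icc.2 hT) ht ht.1
    have h1 : u t ≤ u T := hmono ht (right_mem_Icc.2 hT) ht.2
    rw [hu0] at h0
    rw [huT] at h1
    constructor
    · exact div_nonneg (sub_nonneg.2 (Real.log_le_log hx h0)) hVpos.le
    · rw [hs, div_le_one hVpos, hV]
      linarith [Real.log_le_log (huv t ht).1.1 h1]
  have hsV : ∀ t, (Real.log x : ℂ) + s t * V = Real.log (u t) := fun t => by
    rw [hs]
    push_cast
    field_simp
    ring
  have hsd : ∀ t ∈ Icc 0 T, HasDerivWithinAt s ((1 + X.a (u t, v t)) / V) (Icc 0 T) t :=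
    fun t ht => by
      have hne := (huv t ht).1.1.ne'
      refine ((((huv t ht).2.2.1.log hne).sub_const (Real.log x)).div_const V).congr_deriv ?_
      field_simp
  have hlog_lt : ∀ z : ℝ, z ∈ Ioo 0 r → Real.log z < Real.log r := fun z hz =>
    Real.log_lt_log hz.1 hz.2
  have key := eqOn_of_solutions (T := T) (K := 2 * K) (V := {η | η.re < Real.log r})
    (F := fun t η => (1 + X.a (u t, v t) : ℝ) * X.h (Real.log (u t)) η)
    (y := fun t => (Real.log (v t) : ℂ)) (z := fun t => y (s t)) ?_ ?_ ?_ ?_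
  · have h1 := key (right_mem_Icc.2 hT)
    have h2 : s T = 1 := by
      simp only [hs]
      rw [huT, ← hV, div_self hVpos.ne']
    have h3 : Real.log y' = (y 1).re := by
      simp only [hvT, h2] at h1
      rw [← h1, Complex.ofReal_re]
    rw [← h3, Real.exp_log]
    rw [← hvT]
    exact (huv T (right_mem_Icc.2 hT)).2.1.1
  · intro t ht η hη η' hη'
    have h1 := hh (Real.log (u t)) η η'
      (by rw [Complex.ofReal_re]; exact hlog_lt _ (huv t ht).1) hη hη'
    have h2 := abs_le.1 (ha t ht)
    rw [← mul_sub, norm_mul, mul_assoc, Complex.norm_real]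
    have h3 : ‖1 + X.a (u t, v t)‖ ≤ 2 := by
      rw [Real.norm_eq_abs, abs_le]
      constructor <;> linarith [h2.1, h2.2]
    gcongr
  · intro t ht
    obtain ⟨hut, hvt, -, hvd⟩ := huv t ht
    refine ⟨by rw [mem_ofPred_eq, Complex.ofReal_re]; exact hlog_lt _ hvt, ?_⟩
    refine ((hvd.log hvt.1.ne').ofReal_comp).congr_deriv ?_
    have hu' : Complex.exp (Real.log (u t)) = u t := by
      rw [← Complex.ofReal_exp, Real.exp_log hut.1]
    have hv' : Complex.exp (Real.log (v t)) = v t := by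
      rw [← Complex.ofReal_exp, Real.exp_log hvt.1]
    have h1 : (1 : ℂ) + X.a (u t, v t) ≠ 0 := by
      have := (abs_le.1 (ha t ht)).1
      exact_mod_cast (by linarith : 0 < 1 + X.a (u t, v t)).ne'
    have h2 : (v t : ℂ) ≠ 0 := by exact_mod_cast hvt.1.ne'
    rw [h, hu', hv', q, hX.A_ofReal _ _ (hab t ht).1 (hab t ht).2,
      hX.B_ofReal _ _ (hab t ht).1 (hab t ht).2]
    push_cast
    field_simp
  · intro t ht
    refine ⟨hy.re_lt _ (hsI t ht), ?_⟩
    have h1 := hy.hasDeriv _ (hsI t ht)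
    rw [hVc, hsV] at h1
    refine (h1.scomp t (hsd t ht) fun t' ht' => hsI t' ht').congr_deriv ?_
    rw [Complex.real_smul]
    push_cast
    field_simp
  · have : s 0 = 0 := by simp [hs, hu0]
    simp only [this, hv0, hy.init]

theorem IsHolonomy.unique (hX : X.IsRegular R) (hrR : r < R) {c : ℝ} (hc : 0 < c)
    {w w₁ w₂ : ℂ} (h₁ : X.IsHolonomy r c w w₁) (h₂ : X.IsHolonomy r c w w₂) : w₁ = w₂ := by
  obtain ⟨γ, hγ, hγx, hγ0, rfl⟩ := h₁
  obtain ⟨δ, hδ, hδx, hδ0, rfl⟩ := h₂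
  have hpi : (0 : ℝ) < 2 * Real.pi := by positivity
  obtain ⟨K, hK, hq⟩ := hX.exists_lipschitz_q hrR
  have hα := hX.α_pos
  have hr : 0 ≤ r := (norm_nonneg _).trans (hγ 0 (left_mem_Icc.2 hpi.le)).1.le
  -- both lifts solve `dy / dθ = -i α y q`
  have aux : ∀ γ : ℝ → ℂ × ℂ, X.IsLeafPath r (2 * Real.pi) γ →
      (∀ θ ∈ Icc 0 (2 * Real.pi), (γ θ).1 = c * Complex.exp (θ * Complex.I)) →
      ∀ t ∈ Icc 0 (2 * Real.pi), (γ t).2 ∈ Metric.ball (0 : ℂ) r ∧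
        HasDerivWithinAt (fun t => (γ t).2) (-(Complex.I * X.α) *
          ((γ t).2 * X.q (c * Complex.exp (t * Complex.I), (γ t).2))) (Icc 0 (2 * Real.pi)) t := by
    intro γ hγ hγx t ht
    obtain ⟨h1, h2, -, v, hv, hform⟩ := hγ t ht
    refine ⟨mem_ball_zero_iff.2 h2, ?_⟩
    have hv1 : HasDerivWithinAt (fun t => (γ t).1) v.1 (Icc 0 (2 * Real.pi)) t := hv.fst
    have hv2 : HasDerivWithinAt (fun t => (γ t).2) v.2 (Icc 0 (2 * Real.pi)) t := hv.snd
    have hx : HasDerivWithinAt (fun t => (γ t).1) (Complex.I * (γ t).1)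
        (Icc 0 (2 * Real.pi)) t := by
      have h3 : HasDerivAt (fun θ : ℝ => (c : ℂ) * Complex.exp (θ * Complex.I))
          (Complex.I * (c * Complex.exp (t * Complex.I))) t := by
        have := (((hasDerivAt_id t).ofReal_comp.mul_const Complex.I).cexp).const_mul (c : ℂ)
        refine this.congr_deriv ?_
        simp
        ring
      rw [hγx t ht]
      exact h3.hasDerivWithinAt.congr (fun θ hθ => hγx θ hθ) (hγx t ht)
    have hv1' := (uniqueDiffOn_Icc hpi t ht).eq_deriv _ hv1 hx
    have hx0 : (γ t).1 ≠ 0 := by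
      rw [hγx t ht]
      exact mul_ne_zero (by exact_mod_cast hc.ne') (Complex.exp_ne_zero _)
    have hA := hX.one_add_A_ne_zero (mem_ball_prod (h1.trans hrR) (h2.trans hrR))
    refine hv2.congr_deriv ?_
    rw [form, hv1'] at hform
    rw [← hγx t ht, q]
    have h4 : (γ t).1 * ((1 + X.A ((γ t).1, (γ t).2)) * v.2 +
        Complex.I * X.α * (γ t).2 * (1 + X.B ((γ t).1, (γ t).2))) = 0 := by
      linear_combination hform
    have h5 := (mul_eq_zero.1 h4).resolve_left hx0
    field_simp
    linear_combination h5
  refine eqOn_of_solutions (K := X.α * (5 / 4 + r * K)) (V := Metric.ball 0 r)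
    (F := fun t y => -(Complex.I * X.α) * (y * X.q (c * Complex.exp (t * Complex.I), y)))
    ?_ (aux γ hγ hγx) (aux δ hδ hδx) (hγ0.trans hδ0.symm) (right_mem_Icc.2 hpi.le)
  intro t ht y hy y' hy'
  rw [mem_ball_zero_iff] at hy hy'
  have hxr : ‖(c : ℂ) * Complex.exp (t * Complex.I)‖ < r := by
    rw [← hγx t ht]
    exact (hγ t ht).1
  set x := (c : ℂ) * Complex.exp (t * Complex.I)
  have h1 := hq x y y' hxr hy hy'
  have h2 := hX.norm_q (mem_ball_prod (hxr.trans hrR) (hy.trans hrR))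
  rw [← mul_sub, norm_mul, norm_neg, norm_mul, Complex.norm_I, one_mul, Complex.norm_real,
    Real.norm_of_nonneg hα.le, mul_assoc]
  gcongr
  have h3 : y * X.q (x, y) - y' * X.q (x, y') =
      (y - y') * X.q (x, y) + y' * (X.q (x, y) - X.q (x, y')) := by ring
  rw [h3]
  calc _ ≤ ‖y - y'‖ * ‖X.q (x, y)‖ + ‖y'‖ * ‖X.q (x, y) - X.q (x, y')‖ := by
        rw [← norm_mul, ← norm_mul]
        exact norm_add_le _ _
    _ ≤ ‖y - y'‖ * (5 / 4) + r * (K * ‖y - y'‖) := by gcongr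
    _ = _ := by ring

/-! ### The Dulac map after a full turn -/

variable (X) in
/-- The real Dulac map (junk where undefined). -/
def dulac (r c₁ c₂ : ℝ) (x : ℝ) : ℝ :=
  Classical.epsilon fun y => X.IsDulac r c₁ c₂ x y

theorem IsRegular.dulac_eq (hX : X.IsRegular R) (hr : 0 < r) (hrR : r < R) {c₁ c₂ x : ℝ}
    (hc₁ : 0 < c₁) (hc₂ : 0 < c₂) (hc₂r : c₂ < r) (hx : 0 < x) (hxc : x < c₂) {y : ℝ → ℂ}
    (hy : X.IsLift r (Real.log c₁) (Real.log x) (Real.log c₂ - Real.log x) y)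
    (hreal : ∀ s ∈ Icc (0 : ℝ) 1, (y s).im = 0) :
    (∃! y', X.IsDulac r c₁ c₂ x y') ∧ (X.dulac r c₁ c₂ x : ℂ) = Complex.exp (y 1) := by
  have h1 := hy.isDulac hX hr hrR hc₁ hc₂ hc₂r hx hxc hreal
  have h2 : ∀ y', X.IsDulac r c₁ c₂ x y' → y' = Real.exp (y 1).re := fun y' h =>
    hy.dulac_unique hX hr hrR hx hxc h
  refine ⟨⟨_, h1, h2⟩, ?_⟩
  rw [dulac, h2 _ (Classical.epsilon_spec (p := fun y' => X.IsDulac r c₁ c₂ x y') ⟨_, h1⟩)]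
  conv_rhs => rw [← Complex.re_add_im (y 1), hreal 1 (by simp)]
  simp

/-- A lift which is holomorphic in the end point of the segment solves the complex differential
equation of the leaves with respect to the end point: the radial derivative is prescribed, and it
determines the complex one. -/
theorem hasDerivAt_lift_end (hX : X.IsRegular R) (hr : 0 < r) (hrR : r < R) {η₀ ζ : ℂ}
    (hζ : ζ.re < Real.log r) {U : Set ℂ} (hU : IsOpen U) (hUr : ∀ p ∈ U, p.re < Real.log r)
    {Y : ℝ → ℂ → ℂ} (hY : ∀ p ∈ U, X.IsLift r η₀ ζ (p - ζ) (fun s => Y s p))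
    (hd : DifferentiableOn ℂ (Y 1) U) {p : ℂ} (hp : p ∈ U) (hne : p ≠ ζ) :
    HasDerivAt (Y 1) (X.h p (Y 1 p)) p := by
  have h1 : HasDerivAt (Y 1) (deriv (Y 1) p) p :=
    (hd.differentiableAt (hU.mem_nhds hp)).hasDerivAt
  have h1' : (1 : ℝ) ∈ Icc (0 : ℝ) 1 := by simp
  have hline : HasDerivAt (fun s : ℝ => ζ + s * (p - ζ)) (p - ζ) 1 := by
    have := (((hasDerivAt_id (1 : ℝ)).ofReal_comp).mul_const (p - ζ)).const_add ζ
    simpa using this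
  have hp1 : ζ + ((1 : ℝ) : ℂ) * (p - ζ) = p := by push_cast; ring
  have h2 : HasDerivWithinAt (fun s : ℝ => Y 1 (ζ + s * (p - ζ)))
      ((p - ζ) * deriv (Y 1) p) (Icc 0 1) 1 := by
    have h3 : HasDerivAt (Y 1) (deriv (Y 1) p) (ζ + ((1 : ℝ) : ℂ) * (p - ζ)) := by rwa [hp1]
    have := h3.scomp (1 : ℝ) hline
    rw [smul_eq_mul] at this
    exact this.hasDerivWithinAt
  -- close to `s = 1` the lift to `ζ + s (p - ζ)` is a part of the lift to `p`
  have h4 : (fun s : ℝ => Y 1 (ζ + s * (p - ζ))) =ᶠ[𝓝[Icc 0 1] 1] fun s => Y s p := by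
    have h5 : ∀ᶠ s : ℝ in 𝓝 1, ζ + s * (p - ζ) ∈ U := by
      have := hline.continuousAt.tendsto
      rw [hp1] at this
      exact this.eventually (hU.mem_nhds hp)
    filter_upwards [self_mem_nhdsWithin, h5.filter_mono nhdsWithin_le_nhds] with s hs hsU
    have h6 : X.IsLift r η₀ ζ (ζ + s * (p - ζ) - ζ) (fun t => Y (t * s) p) := by
      have hts : MapsTo (fun t : ℝ => t * s) (Icc 0 1) (Icc 0 1) := fun t ht =>
        ⟨mul_nonneg ht.1 hs.1, mul_le_one₀ ht.2 hs.1 hs.2⟩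
      refine ⟨by simpa using (hY p hp).init, fun t ht => (hY p hp).re_lt _ (hts ht),
        fun t ht => ?_⟩
      have h7 := ((hY p hp).hasDeriv _ (hts ht)).scomp t
        (((hasDerivAt_id t).mul_const s).hasDerivWithinAt (s := Icc 0 1)) hts
      refine h7.congr_deriv ?_
      have h8 : ζ + t * (ζ + s * (p - ζ) - ζ) = ζ + ((t * s : ℝ) : ℂ) * (p - ζ) := by
        push_cast; ring
      rw [h8, Complex.real_smul]
      push_cast
      ring
    have h9 := (hY _ hsU).eqOn hX hr hrR hζ (by rw [add_sub_cancel]; exact hUr _ hsU) rfl h6 h1'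
    simpa using h9
  have h5 := (hY p hp).hasDeriv 1 h1'
  rw [hp1] at h5
  have h6 := (h2.congr_of_eventuallyEq_of_mem h4.symm h1')
  have h7 := (uniqueDiffOn_Icc zero_lt_one 1 h1').eq_deriv _ h6 h5
  rwa [mul_left_cancel₀ (sub_ne_zero.2 hne) h7] at h1

/-- The statement for the Dulac map of one foliation. The continuation of the Dulac map at
`exp (2 π i) x` is transport from `log x + 2 π i` to `log c₂`, which by periodicity is transport
from `log x` to `log c₂ - 2 π i`; letting the end point move up to `log c₂` gives the holonomy
lift, which ends at the transport from `log x` to `log c₂`, i.e. at the Dulac map. -/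
theorem IsRegular.holonomy_dulac (hX : X.IsRegular R) (hr : 0 < r) (hrR : r < R) {c₁ c₂ x : ℝ}
    (hc₁ : c₁ ∈ Ioo 0 r) (hc₂ : c₂ ∈ Ioo 0 r) (hx : 0 < x) (hxc : x < c₂ * Real.exp (-10)) :
    (∃! y', X.IsDulac r c₁ c₂ x y') ∧
      (∃! w, IsArcContinuation (X.dulac r c₁ c₂) x w) ∧
      (∃! w', X.IsHolonomy r c₂ (arcContinuation (X.dulac r c₁ c₂) x) w') ∧
      Classical.epsilon (X.IsHolonomy r c₂ (arcContinuation (X.dulac r c₁ c₂) x)) =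
        (X.dulac r c₁ c₂ x : ℂ) := by
  set ℓ := Real.log x with hℓ
  set L := Real.log c₂ with hL
  -- the segments used below have `|Im v| < 8`, as `2 π < 8`, and `Re v > 8`: `ℓ` and `L` are more
  -- than `10` apart, and the end points come closer to each other by at most `1`
  have hℓL : ℓ + 10 < L := by
    have := Real.log_lt_log hx hxc
    rw [Real.log_mul hc₂.1.ne' (Real.exp_pos _).ne', Real.log_exp] at this
    linarith
  have hLr : L < Real.log r := Real.log_lt_log hc₂.1 hc₂.2
  have hc₁r : Real.log c₁ < Real.log r := Real.log_lt_log hc₁.1 hc₁.2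
  have hpi4 : 2 * Real.pi < 8 := by linarith [Real.pi_lt_four]
  have hpi0 : 0 < 2 * Real.pi := by positivity
  -- transport to `log c₂`, as a function of the starting point
  set U₁ : Set ℂ := {p | |p.im| < 8} ∩ {p | ℓ - 1 < p.re} ∩ {p | p.re < ℓ + 1} with hU₁
  have hU₁o : IsOpen U₁ :=
    ((isOpen_lt (by fun_prop) (by fun_prop)).inter (isOpen_lt (by fun_prop) (by fun_prop))).inter
      (isOpen_lt (by fun_prop) (by fun_prop))
  obtain ⟨Y₁, hY₁, -, hY₁d, hY₁r⟩ := hX.exists_lift hr hrR hc₁r hU₁o (m := L - ℓ + 1)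
    (ζ := fun p => p) (v := fun p => L - p) (by fun_prop) (by fun_prop)
    (fun p hp => by
      obtain ⟨⟨h1, h2⟩, h3⟩ := hp
      simp only [mem_ofPred_eq] at h1 h2 h3
      simp only [Complex.sub_re, Complex.sub_im, Complex.ofReal_re, Complex.ofReal_im, zero_sub,
        abs_neg]
      constructor <;> linarith)
    (fun p hp => by
      have := hp.2
      simp only [mem_ofPred_eq] at this
      linarith)
    (fun p hp => by simpa using hLr)
  -- transport from `log x`, as a function of the end point
  set U₂ : Set ℂ := {p | |p.im| < 8} ∩ {p | L - 1 < p.re} ∩ {p | p.re < Real.log r} with hU₂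
  have hU₂o : IsOpen U₂ :=
    ((isOpen_lt (by fun_prop) (by fun_prop)).inter (isOpen_lt (by fun_prop) (by fun_prop))).inter
      (isOpen_lt (by fun_prop) (by fun_prop))
  have hℓr : ((ℓ : ℂ)).re < Real.log r := by
    rw [Complex.ofReal_re]
    linarith
  obtain ⟨Y₂, hY₂, hY₂c, hY₂d, -⟩ := hX.exists_lift hr hrR hc₁r hU₂o (m := Real.log r - ℓ)
    (ζ := fun _ => (ℓ : ℂ)) (v := fun p => p - ℓ) (by fun_prop) (by fun_prop)
    (fun p hp => by
      obtain ⟨⟨h1, h2⟩, h3⟩ := hp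
      simp only [mem_ofPred_eq] at h1 h2 h3
      simp only [Complex.sub_re, Complex.sub_im, Complex.ofReal_re, Complex.ofReal_im, sub_zero]
      constructor <;> linarith)
    (fun p hp => hℓr)
    (fun p hp => by simpa using hp.2)
  have hreal₁ : ∀ s : ℝ, (Real.log s : ℂ) ∈ U₁ → ∀ t ∈ Icc (0 : ℝ) 1,
      (Y₁ t (Real.log s)).im = 0 := fun s hs =>
    hY₁r _ hs (Complex.ofReal_im _) (by simp)
  have hxU₁ : (ℓ : ℂ) ∈ U₁ := by
    refine ⟨⟨?_, ?_⟩, ?_⟩ <;> simp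
  have hdul : ∀ s : ℝ, 0 < s → (Real.log s : ℂ) ∈ U₁ →
      (∃! y', X.IsDulac r c₁ c₂ s y') ∧
        (X.dulac r c₁ c₂ s : ℂ) = Complex.exp (Y₁ 1 (Real.log s)) := by
    intro s hs hsU
    have hsc : s < c₂ := by
      rw [← Real.log_lt_log_iff hs hc₂.1]
      have := hsU.2
      simp only [mem_ofPred_eq, Complex.ofReal_re] at this
      linarith
    exact hX.dulac_eq hr hrR hc₁.1 hc₂.1 hc₂.2 hs hsc (hY₁ _ hsU) (hreal₁ s hsU)
  obtain ⟨hex, hdx⟩ := hdul x hx hxU₁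
  have harc : IsArcContinuation (X.dulac r c₁ c₂) x
      (Complex.exp (Y₁ 1 (ℓ + 2 * Real.pi * Complex.I))) := by
    refine isArcContinuation_of_log hx hU₁o (G := fun p => Complex.exp (Y₁ 1 p)) hY₁d.cexp
      (fun θ hθ => ?_) ?_
    · obtain ⟨h1, h2⟩ := hθ
      refine ⟨⟨?_, ?_⟩, ?_⟩
      · simp only [mem_ofPred_eq, Complex.add_im, Complex.ofReal_im, Complex.im_ofReal_mul,
          Complex.I_im, mul_one, zero_add]
        rw [abs_of_nonneg h1]
        linarith
      · simp [hℓ]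
      · simp [hℓ]
    · have h1 : Tendsto (fun s => (Real.log s : ℂ)) (𝓝 x) (𝓝 ℓ) :=
        (Complex.continuous_ofReal.tendsto _).comp (Real.continuousAt_log hx.ne').tendsto
      filter_upwards [h1.eventually (hU₁o.mem_nhds hxU₁), eventually_gt_nhds hx] with s hs hs0
      exact (hdul s hs0 hs).2.symm
  have hw : arcContinuation (X.dulac r c₁ c₂) x
      = Complex.exp (Y₁ 1 (ℓ + 2 * Real.pi * Complex.I)) :=
    (Classical.epsilon_spec (p := IsArcContinuation (X.dulac r c₁ c₂) x) ⟨_, harc⟩).unique harc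
  -- the lift of the loop `x = c₂ exp (i θ)`
  set e : ℝ → ℂ := fun θ => L + (θ - 2 * Real.pi) * Complex.I with he
  have heU : ∀ θ ∈ Icc 0 (2 * Real.pi), e θ ∈ U₂ := by
    intro θ hθ
    refine ⟨⟨?_, ?_⟩, ?_⟩
    · have : (e θ).im = θ - 2 * Real.pi := by simp [he]
      simp only [mem_ofPred_eq, this]
      rw [abs_lt]
      constructor <;> linarith [hθ.1, hθ.2]
    · simp [he]
    · simpa [he] using hLr
  have hexp : ∀ θ : ℝ, Complex.exp (e θ) = c₂ * Complex.exp (θ * Complex.I) := by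
    intro θ
    have h1 : e θ = L + θ * Complex.I - 2 * Real.pi * Complex.I := by simp only [he]; ring
    rw [h1, Complex.exp_sub, Complex.exp_two_pi_mul_I, div_one, Complex.exp_add,
      ← Complex.ofReal_exp, hL, Real.exp_log hc₂.1]
  have hstart : Y₂ 1 (e 0) = Y₁ 1 (ℓ + 2 * Real.pi * Complex.I) := by
    have hmem : (ℓ : ℂ) + 2 * Real.pi * Complex.I ∈ U₁ := by
      refine ⟨⟨?_, ?_⟩, ?_⟩
      · simp only [mem_ofPred_eq]
        have : ((ℓ : ℂ) + 2 * Real.pi * Complex.I).im = 2 * Real.pi := by simp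
        rw [this, abs_of_pos hpi0]
        exact hpi4
      · simp
      · simp
    have h1 := hY₂ _ (heU 0 ⟨le_rfl, hpi0.le⟩)
    have h2 := hY₁ _ hmem
    have h3 : (L : ℂ) - (ℓ + 2 * Real.pi * Complex.I) = e 0 - ℓ := by
      simp only [he]; push_cast; ring
    rw [h3] at h2
    refine h1.eqOn hX hr hrR hℓr ?_ ?_ h2 (right_mem_Icc.2 zero_le_one)
    · rw [add_sub_cancel]
      exact (heU 0 ⟨le_rfl, hpi0.le⟩).2
    · rw [Complex.exp_add, Complex.exp_two_pi_mul_I, mul_one]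
  have hend : Y₂ 1 (e (2 * Real.pi)) = Y₁ 1 ℓ := by
    have h1 := hY₂ _ (heU (2 * Real.pi) ⟨hpi0.le, le_rfl⟩)
    have h2 := hY₁ _ hxU₁
    have h3 : (L : ℂ) - ℓ = e (2 * Real.pi) - ℓ := by
      simp only [he]; push_cast; ring
    rw [h3] at h2
    refine h1.eqOn hX hr hrR hℓr ?_ rfl h2 (right_mem_Icc.2 zero_le_one)
    rw [add_sub_cancel]
    exact (heU _ ⟨hpi0.le, le_rfl⟩).2
  have hhol : X.IsHolonomy r c₂ (arcContinuation (X.dulac r c₁ c₂) x) (X.dulac r c₁ c₂ x) := by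
    refine ⟨fun θ => (Complex.exp (e θ), Complex.exp (Y₂ 1 (e θ))), fun θ hθ => ?_,
      fun θ _ => hexp θ, ?_, ?_⟩
    · have hp := heU θ hθ
      have h1 : ‖Complex.exp (e θ)‖ < r := norm_exp_lt hr hp.2
      have h2 : ‖Complex.exp (Y₂ 1 (e θ))‖ < r :=
        norm_exp_lt hr ((hY₂c _ hp).trans_lt hc₁r)
      refine ⟨h1, h2, fun h0 => Complex.exp_ne_zero _ (congrArg Prod.fst h0),
        (Complex.exp (e θ) * Complex.I,
          Complex.exp (Y₂ 1 (e θ)) * (Complex.I * X.h (e θ) (Y₂ 1 (e θ)))), ?_, ?_⟩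
      · have hne : e θ ≠ ℓ := by
          intro h0
          have h3 := hp.1.2
          rw [h0] at h3
          simp only [mem_ofPred_eq, Complex.ofReal_re] at h3
          linarith
        have hde : HasDerivAt e Complex.I θ := by
          have := ((((hasDerivAt_id θ).ofReal_comp).sub_const (2 * Real.pi : ℂ)).mul_const
            Complex.I).const_add (L : ℂ)
          refine this.congr_deriv ?_
          simp
        have hdY := (hasDerivAt_lift_end hX hr hrR hℓr hU₂o (fun p hp => hp.2) hY₂ hY₂d hp
          hne).scomp θ hde
        rw [smul_eq_mul] at hdY
        exact (hde.cexp.prodMk hdY.cexp).hasDerivWithinAt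
      · have hA := hX.one_add_A_ne_zero (mem_ball_prod (h1.trans hrR) (h2.trans hrR))
        simp only [form, h, q]
        field_simp
        ring
    · rw [hw, ← hstart]
    · rw [hdx, ← hend]
  refine ⟨hex, ⟨_, harc, fun w' hw' => hw'.unique harc⟩,
    ⟨_, hhol, fun w' hw' => hw'.unique hX hrR hc₂.1 hhol⟩, ?_⟩
  exact (Classical.epsilon_spec (p := X.IsHolonomy r c₂ (arcContinuation (X.dulac r c₁ c₂) x))
    ⟨_, hhol⟩).unique hX hrR hc₂.1 hhol

/-! ### Exchange of the coordinates -/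

variable (X) in
/-- The same foliation with the two coordinates exchanged and the form divided by `α`. -/
def swap : Saddle where
  α := X.α⁻¹
  a p := X.b p.swap
  b p := X.a p.swap
  A p := X.B p.swap
  B p := X.A p.swap

theorem swap_swap (X : Saddle) : X.swap.swap = X := by
  cases X
  simp [swap]

theorem IsRegular.swap (hX : X.IsRegular R) : X.swap.IsRegular R := by
  have hball : MapsTo Prod.swap (Metric.ball (0 : ℂ × ℂ) R) (Metric.ball 0 R) := by
    rintro ⟨x, y⟩ hp
    rw [mem_ball_zero_iff, Prod.norm_def] at *
    rwa [max_comm]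
  have hd : DifferentiableOn ℂ (Prod.swap : ℂ × ℂ → ℂ × ℂ) (Metric.ball 0 R) :=
    (differentiable_snd.prodMk differentiable_fst).differentiableOn
  exact ⟨inv_pos.2 hX.α_pos, hX.differentiableOn_B.comp hd hball,
    hX.differentiableOn_A.comp hd hball, fun p hp => hX.norm_B _ (hball hp),
    fun p hp => hX.norm_A _ (hball hp), fun x y hx hy => hX.B_ofReal y x hy hx,
    fun x y hx hy => hX.A_ofReal y x hy hx⟩

/-- Reversing the time of an orbit, and rescaling it by `α`. -/
theorem IsDulac.swap (hα : 0 < X.α) {c₁ c₂ x y : ℝ} (h : X.IsDulac r c₁ c₂ x y) :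
    X.swap.IsDulac r c₂ c₁ y x := by
  obtain ⟨T, u, v, hT, huv, hu0, hv0, huT, hvT⟩ := h
  have hmaps : MapsTo (fun t => T - t * X.α⁻¹) (Icc 0 (X.α * T)) (Icc 0 T) := by
    intro t ht
    have h1 : 0 ≤ t * X.α⁻¹ := mul_nonneg ht.1 (inv_pos.2 hα).le
    have h2 : t * X.α⁻¹ ≤ T := by
      rw [← div_eq_mul_inv, div_le_iff₀ hα, mul_comm T]
      exact ht.2
    constructor <;> dsimp only <;> linarith
  have hd : ∀ t, HasDerivWithinAt (fun t => T - t * X.α⁻¹) (-X.α⁻¹) (Icc 0 (X.α * T)) t :=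
    fun t => by
      have := ((hasDerivAt_id t).mul_const X.α⁻¹).const_sub T
      rw [one_mul] at this
      exact this.hasDerivWithinAt
  have hend : T - X.α * T * X.α⁻¹ = 0 := by field_simp; ring
  refine ⟨X.α * T, fun t => v (T - t * X.α⁻¹), fun t => u (T - t * X.α⁻¹), by positivity,
    fun t ht => ?_, by simp [hvT], by simp [huT], by simp only [hend, hv0],
    by simp only [hend, hu0]⟩
  obtain ⟨h1, h2, h3, h4⟩ := huv _ (hmaps ht)
  refine ⟨h2, h1, (h4.comp t (hd t) hmaps).congr_deriv ?_, (h3.comp t (hd t) hmaps).congr_deriv ?_⟩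
  · simp only [Saddle.swap, Prod.swap_prod_mk]
    field_simp
  · simp only [Saddle.swap, Prod.swap_prod_mk]
    ring

theorem isDulac_swap_iff (hα : 0 < X.α) {c₁ c₂ x y : ℝ} :
    X.swap.IsDulac r c₂ c₁ y x ↔ X.IsDulac r c₁ c₂ x y := by
  refine ⟨fun h => ?_, fun h => h.swap hα⟩
  have := h.swap (inv_pos.2 hα)
  rwa [swap_swap] at this

theorem IsLeafPath.swap (hα : X.α ≠ 0) {T : ℝ} {γ : ℝ → ℂ × ℂ} (h : X.IsLeafPath r T γ) :
    X.swap.IsLeafPath r T (fun t => (γ t).swap) := by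
  intro t ht
  obtain ⟨h1, h2, h3, v, hv, hform⟩ := h t ht
  refine ⟨h2, h1, fun h0 => h3 (Prod.swap_injective (h0.trans Prod.swap_zero.symm)), v.swap,
    hv.snd.prodMk hv.fst, ?_⟩
  have h4 : X.swap.form (γ t).swap v.swap = (X.α : ℂ)⁻¹ * X.form (γ t) v := by
    have : (X.α : ℂ) ≠ 0 := by exact_mod_cast hα
    simp only [form, Saddle.swap, Prod.fst_swap, Prod.snd_swap, Prod.swap_prod_mk]
    push_cast
    field_simp
    ring
  rw [h4, hform, mul_zero]

end Saddle

/-! ### The family -/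

namespace Family

variable {N : ℕ} (S : Family N)

/-- The foliation of the family at the parameter `lam`. -/
def saddle (lam : EuclideanSpace ℝ (Fin N)) : Saddle where
  α := S.α lam
  a p := S.a (p.1, p.2, lam)
  b p := S.b (p.1, p.2, lam)
  A p := complexification S.a (p.1, p.2, toComplexParam lam)
  B p := complexification S.b (p.1, p.2, toComplexParam lam)

theorem isHolonomyσ_iff {r c : ℝ} {lam : EuclideanSpace ℝ (Fin N)} (hα : S.α lam ≠ 0)
    {z z' : ℂ} : S.IsHolonomyσ r c lam z z' ↔ (S.saddle lam).swap.IsHolonomy r c z z' := by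
  constructor
  · rintro ⟨γ, h, h1, h2, h3⟩
    exact ⟨fun t => (γ t).swap, Saddle.IsLeafPath.swap (X := S.saddle lam) hα h, h1, h2, h3⟩
  · rintro ⟨γ, h, h1, h2, h3⟩
    have h4 := Saddle.IsLeafPath.swap (X := (S.saddle lam).swap) (inv_ne_zero hα) h
    rw [Saddle.swap_swap] at h4
    exact ⟨fun t => (γ t).swap, h4, h1, h2, h3⟩

theorem norm_toComplexParam (lam : EuclideanSpace ℝ (Fin N)) : ‖toComplexParam lam‖ = ‖lam‖ := by
  simp [EuclideanSpace.norm_eq, toComplexParam]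

/-- On a fixed polydisc, all foliations of the family for small parameters are regular. -/
theorem exists_isRegular : ∃ R > 0, ∀ lam : EuclideanSpace ℝ (Fin N), ‖lam‖ < R →
    (S.saddle lam).IsRegular R := by
  -- `R` may be shrunk, to have one radius for `a`, `b` and `α`
  have aux : ∀ f : RealSpace N → ℝ, AnalyticAt ℝ f 0 →
      (∀ᶠ lam in 𝓝 (0 : EuclideanSpace ℝ (Fin N)), f (0, 0, lam) = 0) →
      ∃ R > 0, ∀ R' ≤ R, ∀ lam : EuclideanSpace ℝ (Fin N), ‖lam‖ < R' →
        DifferentiableOn ℂ (fun p : ℂ × ℂ => complexification f (p.1, p.2, toComplexParam lam))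
          (Metric.ball 0 R') ∧
        (∀ p ∈ Metric.ball (0 : ℂ × ℂ) R',
          ‖complexification f (p.1, p.2, toComplexParam lam)‖ ≤ 1 / 10) ∧
        ∀ x y : ℝ, |x| < R' → |y| < R' →
          complexification f (x, y, toComplexParam lam) = f (x, y, lam) := by
    intro f hf hf0
    obtain ⟨hF, hFf⟩ := complexification_spec f hf
    have h0 : complexification f 0 = 0 := by
      have h1 := hFf.self_of_nhds
      have h2 : toComplexSpace (0 : RealSpace N) = 0 := by
        simp [toComplexSpace, toComplexParam, Prod.ext_iff]
        rfl
      have h3 : f 0 = 0 := hf0.self_of_nhds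
      rwa [h2, h3, Complex.ofReal_zero] at h1
    have h1 : ∀ᶠ P in 𝓝 (0 : ComplexSpace N), ‖complexification f P‖ < 1 / 10 := by
      have := hF.continuousAt.norm.tendsto
      rw [h0, norm_zero] at this
      exact this.eventually_lt_const (by norm_num)
    obtain ⟨R₁, hR₁, hb₁⟩ := Metric.eventually_nhds_iff_ball.1
      (hF.eventually_analyticAt.and h1)
    obtain ⟨R₂, hR₂, hb₂⟩ := Metric.eventually_nhds_iff_ball.1 hFf
    refine ⟨min R₁ R₂, lt_min hR₁ hR₂, fun R' hR' lam hlam => ?_⟩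
    have hmem : ∀ p ∈ Metric.ball (0 : ℂ × ℂ) R',
        ((p.1, p.2, toComplexParam lam) : ComplexSpace N) ∈ Metric.ball 0 R₁ := by
      intro p hp
      rw [mem_ball_zero_iff, Prod.norm_def] at hp
      rw [mem_ball_zero_iff, Prod.norm_def, Prod.norm_def, norm_toComplexParam]
      refine lt_of_lt_of_le ?_ (hR'.trans (min_le_left _ _))
      exact max_lt ((le_max_left _ _).trans_lt hp) (max_lt ((le_max_right _ _).trans_lt hp) hlam)
    refine ⟨fun p hp => ?_, fun p hp => (hb₁ _ (hmem p hp)).2.le, fun x y hx hy => ?_⟩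
    · have h2 : DifferentiableAt ℂ (complexification f) (p.1, p.2, toComplexParam lam) :=
        (hb₁ _ (hmem p hp)).1.differentiableAt
      exact (h2.comp (f := fun p : ℂ × ℂ => ((p.1, p.2, toComplexParam lam) : ComplexSpace N))
        p (by fun_prop)).differentiableWithinAt
    · refine hb₂ (x, y, lam) ?_
      rw [mem_ball_zero_iff, Prod.norm_def, Prod.norm_def]
      refine lt_of_lt_of_le ?_ (hR'.trans (min_le_right _ _))
      exact max_lt hx (max_lt hy hlam)
  obtain ⟨R₁, hR₁, h₁⟩ := aux S.a S.analyticAt_a S.a_zero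
  obtain ⟨R₂, hR₂, h₂⟩ := aux S.b S.analyticAt_b S.b_zero
  obtain ⟨R₃, hR₃, h₃⟩ := Metric.eventually_nhds_iff_ball.1
    (S.analyticAt_α.continuousAt.eventually (lt_mem_nhds S.α_pos))
  refine ⟨min R₁ (min R₂ R₃), lt_min hR₁ (lt_min hR₂ hR₃), fun lam hlam => ?_⟩
  obtain ⟨a1, a2, a3⟩ := h₁ _ (min_le_left _ _) lam hlam
  obtain ⟨b1, b2, b3⟩ := h₂ _ ((min_le_right _ _).trans (min_le_left _ _)) lam hlam
  refine ⟨h₃ lam ?_, a1, b1, a2, b2, a3, b3⟩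
  rw [mem_ball_zero_iff]
  exact hlam.trans_le ((min_le_right _ _).trans (min_le_right _ _))

end Family

end SaddleFoliation

end

theorem lemma1 {N : ℕ} (S : SaddleFoliation.Family N) :
    ∀ᶠ r : ℝ in 𝓝[>] 0, ∀ c₁ ∈ Ioo 0 r, ∀ c₂ ∈ Ioo 0 r,
      ∃ ε > 0, ∀ lam : EuclideanSpace ℝ (Fin N), ‖lam‖ < ε →
        (∀ x ∈ Ioo 0 ε,
          (∃! y', S.IsDulac r c₁ c₂ lam x y') ∧
          (∃! w, SaddleFoliation.IsArcContinuation (S.dulac r c₁ c₂ lam) x w) ∧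
          (∃! w', S.IsHolonomyτ r c₂ lam
            (SaddleFoliation.arcContinuation (S.dulac r c₁ c₂ lam) x) w') ∧
          S.holonomyτ r c₂ lam (SaddleFoliation.arcContinuation (S.dulac r c₁ c₂ lam) x) =
            (S.dulac r c₁ c₂ lam x : ℂ)) ∧
        (∀ y ∈ Ioo 0 ε,
          (∃! x', S.IsDulac r c₁ c₂ lam x' y) ∧
          (∃! z, SaddleFoliation.IsArcContinuation (S.dulacInv r c₁ c₂ lam) y z) ∧
          (∃! z', S.IsHolonomyσ r c₁ lam
            (SaddleFoliation.arcContinuation (S.dulacInv r c₁ c₂ lam) y) z') ∧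
          S.holonomyσ r c₁ lam (SaddleFoliation.arcContinuation (S.dulacInv r c₁ c₂ lam) y) =
            (S.dulacInv r c₁ c₂ lam y : ℂ)) := by
  obtain ⟨R, hR, hreg⟩ := S.exists_isRegular
  filter_upwards [Ioo_mem_nhdsGT hR] with r hr c₁ hc₁ c₂ hc₂
  have hpos₁ : 0 < c₁ * Real.exp (-10) := mul_pos hc₁.1 (Real.exp_pos _)
  have hpos₂ : 0 < c₂ * Real.exp (-10) := mul_pos hc₂.1 (Real.exp_pos _)
  refine ⟨min R (min (c₁ * Real.exp (-10)) (c₂ * Real.exp (-10))),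
    lt_min hR (lt_min hpos₁ hpos₂), fun lam hlam => ?_⟩
  have hX := hreg lam (hlam.trans_le (min_le_left _ _))
  have hα : 0 < S.α lam := hX.α_pos
  refine ⟨fun x hx => ?_, fun y hy => ?_⟩
  · exact hX.holonomy_dulac hr.1 hr.2 hc₁ hc₂ hx.1
      (hx.2.trans_le ((min_le_right _ _).trans (min_le_right _ _)))
  · have key := hX.swap.holonomy_dulac hr.1 hr.2 hc₂ hc₁ hy.1
      (hy.2.trans_le ((min_le_right _ _).trans (min_le_left _ _)))
    have hD : ∀ x y, (S.saddle lam).swap.IsDulac r c₂ c₁ y x = S.IsDulac r c₁ c₂ lam x y :=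
      fun x y => propext (SaddleFoliation.Saddle.isDulac_swap_iff (X := S.saddle lam) hα)
    have hDi : (S.saddle lam).swap.dulac r c₂ c₁ = S.dulacInv r c₁ c₂ lam := by
      funext y
      simp only [SaddleFoliation.Saddle.dulac, SaddleFoliation.Family.dulacInv, hD]
    have hH : ∀ z, (S.saddle lam).swap.IsHolonomy r c₁ z = S.IsHolonomyσ r c₁ lam z :=
      fun z => funext fun z' => propext (S.isHolonomyσ_iff hα.ne').symm
    rw [hDi, hH] at key
    simp only [hD] at key
    exact key
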